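/- Let $K$ be a field, let $G$ be a finite simple graph with vertex set $X=\{x_1,\dots,x_n\}$, and let $R=K[x_1,\dots,x_n]$ with its standard grading. Let $I(G)=(x_ux_v \mid \{x_u,x_v\}\text{ is an edge of }G)\subseteq R$ be the edge ideal of $G$. A set $C$ of pairwise disjoint edges of $G$ is called an induced matching if every edge of $G$ contained in $\bigcup_{E\in C}E$ belongs to $C$; let $\nu(G)$ be the maximum size of an induced matching in $G$. For a nonzero finitely generated graded $R$-module $M$ with minimal graded free resolution $$\cdots\to\bigoplus_{j}R(-j)^{\beta_{1,j}(M)}\to\bigoplus_{j}R(-j)^{\beta_{0,j}(M)}\to M\to 0,$$ its Castelnuovo–Mumford regularity is $\operatorname{reg}(M)=\max\{j-i \mid \beta_{i,j}(M)\neq 0\}$. Suppose that $G$ is chordal, i.e. has no induced cycle of length at least $4$. Then $$\operatorname{reg}(R/I(G))=\nu(G),$$ and, if $G$ has at least one edge, $$\operatorname{reg}(I(G))=\nu(G)+1.$$ -/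

import Mathlib

namespace EdgeIdealRegularity

/-! ### Graphs -/

section Graphs

variable {V : Type*}

/-- A graph is chordal if it has no induced cycle of length at least `4`. -/
def IsChordal (G : SimpleGraph V) : Prop :=
  ∀ n : ℕ, 4 ≤ n → IsEmpty (SimpleGraph.cycleGraph n ↪g G)

/-- An induced matching: a set `C` of pairwise disjoint edges of `G` such that every edge of `G`
whose vertices are all covered by `C` (that is, every edge of the subgraph induced on the union of
the members of `C`) belongs to `C`. -/
structure IsInducedMatching (G : SimpleGraph V) (C : Finset (Sym2 V)) : Prop where
  subset_edgeSet : ∀ e ∈ C, e ∈ G.edgeSet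
  disjoint : ∀ e ∈ C, ∀ f ∈ C, e ≠ f → ∀ v : V, v ∈ e → v ∉ f
  induced : ∀ e ∈ G.edgeSet, (∀ v ∈ e, ∃ f ∈ C, v ∈ f) → e ∈ C

/-- The induced matching number `ν(G)`: the maximum size of an induced matching of a graph on a
finite vertex set. -/
noncomputable def inducedMatchingNumber (G : SimpleGraph V) : ℕ :=
  sSup {n : ℕ | ∃ C : Finset (Sym2 V), IsInducedMatching G C ∧ C.card = n}

/-- On a finite vertex set the supremum defining `ν(G)` is attained, so it is a maximum. -/
theorem isGreatest_inducedMatchingNumber [Finite V] (G : SimpleGraph V) :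
    IsGreatest {n : ℕ | ∃ C : Finset (Sym2 V), IsInducedMatching G C ∧ C.card = n}
      (inducedMatchingNumber G) := by
  have hne : {n : ℕ | ∃ C : Finset (Sym2 V), IsInducedMatching G C ∧ C.card = n}.Nonempty := by
    refine ⟨0, ∅, ⟨by simp, by simp, ?_⟩, rfl⟩
    intro e _ h
    induction e with
    | _ a b =>
      obtain ⟨f, hf, _⟩ := h a (Sym2.mem_mk_left a b)
      simp at hf
  have hbd : BddAbove {n : ℕ | ∃ C : Finset (Sym2 V), IsInducedMatching G C ∧ C.card = n} := by
    classical
    have := Fintype.ofFinite V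
    refine ⟨Fintype.card (Sym2 V), ?_⟩
    rintro n ⟨C, _, rfl⟩
    exact Finset.card_le_univ C
  exact ⟨Nat.sSup_mem hne hbd, fun n hn => le_csSup hbd hn⟩

end Graphs

/-! ### The polynomial ring `R = K[x_v : v ∈ V]`, edge ideals and gradings -/

section Gradings

variable {V : Type*} (K : Type*) [Field K]

/-- The edge ideal `I(G)`, generated by the monomials `x_u x_v` with `{u, v}` an edge of `G`. -/
noncomputable def edgeIdeal (G : SimpleGraph V) : Ideal (MvPolynomial V K) :=
  Ideal.span {f | ∃ u v : V, G.Adj u v ∧ f = MvPolynomial.X u * MvPolynomial.X v}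

variable (V) in
/-- The standard grading of `R`, indexed by `ℤ`: the forms of degree `j`, and `0` if `j < 0`. -/
noncomputable def polyGrading : ℤ → Submodule K (MvPolynomial V K)
  | Int.ofNat n => MvPolynomial.homogeneousSubmodule V K n
  | Int.negSucc _ => ⊥

variable {K}

/-- The grading that a homogeneous ideal `I` inherits from `R`. -/
noncomputable def idealGrading (I : Ideal (MvPolynomial V K)) (j : ℤ) : Submodule K I :=
  (polyGrading V K j).comap (I.subtype.restrictScalars K)

/-- The grading that `R ⧸ I` inherits from `R`, for a homogeneous ideal `I`. -/
noncomputable def quotientGrading (I : Ideal (MvPolynomial V K)) (j : ℤ) :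
    Submodule K (MvPolynomial V K ⧸ I) :=
  (polyGrading V K j).map (Ideal.Quotient.mkₐ K I).toLinearMap

variable (V K) in
/-- The grading of the free module `⨁_b R(-d_b)` of finite rank `n`: the component in degree `j` of
`R(-d)` consists of the forms of degree `j - d`. -/
noncomputable def shiftedGrading {n : ℕ} (d : Fin n → ℤ) (j : ℤ) :
    Submodule K (Fin n → MvPolynomial V K) :=
  Submodule.pi Set.univ fun b => polyGrading V K (j - d b)

end Gradings

/-! ### Minimal graded free resolutions and regularity -/

section Resolutions

variable {V K M : Type*} [Field K] [AddCommGroup M] [Module K M] [Module (MvPolynomial V K) M]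

/-- A minimal graded free resolution
`⋯ → F₂ → F₁ → F₀ → M → 0` of a graded `R`-module `M` with graded components `ℳ j`, where
`F_i = ⨁_b R(-deg i b)` has finite rank, all maps are homogeneous of degree `0`, and the image of
each `F_{i+1} → F_i` lies in `𝔪 F_i`, with `𝔪` the ideal generated by the variables. -/
structure MinimalGradedFreeResolution (ℳ : ℤ → Submodule K M) where
  rank : ℕ → ℕ
  deg : ∀ i : ℕ, Fin (rank i) → ℤ
  d : ∀ i : ℕ, (Fin (rank (i + 1)) → MvPolynomial V K) →ₗ[MvPolynomial V K]
    (Fin (rank i) → MvPolynomial V K)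
  ε : (Fin (rank 0) → MvPolynomial V K) →ₗ[MvPolynomial V K] M
  d_homogeneous : ∀ (i : ℕ) (j : ℤ), ∀ x ∈ shiftedGrading V K (deg (i + 1)) j,
    d i x ∈ shiftedGrading V K (deg i) j
  ε_homogeneous : ∀ j : ℤ, ∀ x ∈ shiftedGrading V K (deg 0) j, ε x ∈ ℳ j
  ε_surjective : Function.Surjective ε
  exact_zero : Function.Exact (d 0) ε
  exact_succ : ∀ i : ℕ, Function.Exact (d (i + 1)) (d i)
  minimal : ∀ (i : ℕ) (x : Fin (rank (i + 1)) → MvPolynomial V K) (b : Fin (rank i)),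
    d i x b ∈ MvPolynomial.idealOfVars V K

/-- The graded Betti number `β_{i,j}` read off a minimal graded free resolution: the number of
summands `R(-j)` of `F_i`. -/
noncomputable def MinimalGradedFreeResolution.betti {ℳ : ℤ → Submodule K M}
    (F : MinimalGradedFreeResolution (V := V) ℳ) (i : ℕ) (j : ℤ) : ℕ :=
  Nat.card {b : Fin (F.rank i) // F.deg i b = j}

variable (V) in
/-- `HasRegularity V ℳ r` says that the graded `R`-module with components `ℳ j` has
Castelnuovo–Mumford regularity `r = max {j - i | β_{i,j} ≠ 0}`: a minimal graded free resolution
exists and for each one (they are all isomorphic) this maximum is attained and equals `r`. -/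
def HasRegularity (ℳ : ℤ → Submodule K M) (r : ℤ) : Prop :=
  Nonempty (MinimalGradedFreeResolution (V := V) ℳ) ∧
    ∀ F : MinimalGradedFreeResolution (V := V) ℳ,
      IsGreatest {s : ℤ | ∃ (i : ℕ) (j : ℤ), F.betti i j ≠ 0 ∧ s = j - i} r

end Resolutions

end EdgeIdealRegularity

namespace EdgeIdealRegularity

open MvPolynomial

/-! ### Homogeneous components -/

section Components

variable {V K : Type*} [Field K]

/-! Regularity is read off Koszul homology. The Betti numbers `β_{i,i+s}` of a graded module all
vanish exactly when the strand of the Koszul complex on the variables whose coefficients lie in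
degree `s` is exact. Both implications (`deg_ne_of_koszulExact`, `koszulExact_of_deg_ne`) are
dimension shifting along a given minimal resolution: the Koszul complex of a free module is exact
apart from the constants at `∅`, and minimality controls those constants. No Tor is needed, and the
result applies to every minimal resolution. It remains to decide which strands of `R/I(G)` are
exact.

Upper bound (`IsChordal.quotientKoszulExact`). Write `J_W` for the ideal of the edges inside `W` and
the variables outside `W`. For a vertex `x` of `W`, the sequence `0 → R/(J_W : x)(-1) → R/J_W →
R/(J_W + x) → 0` bounds the strand `s` of `J_W` by the strand `s-1` of the colon ideal and the
strand `s` of the sum. These two ideals are `J_{W'}` with `W' = W \ N(x)` and `W' = W \ {x}`.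
Chordality supplies an edge `vx` in `W` such that every neighbour of `v` in `W` lies in `N[x]`
(`IsChordal.exists_dominated`). An induced matching inside `W \ N(x)` can then be enlarged by `vx`
(`IsInducedMatching.insert_edge`), which pays for the shift by one.

Lower bound, valid for every graph. An induced matching with vertex set `W` gives the Koszul cycle
with coefficient `x_A` at `e_B`, where `A` and `B` collect the smaller and the larger endpoints.
Summing the coefficients at `x_{W \ T} e_T` over all `T` that meet each edge once is a functional
vanishing on boundaries and on the ideal, but not on this cycle. Topologically, the independence
complex of the matching is the boundary of a cross-polytope, hence a sphere.

Resolutions exist by iterating covers with the least number of homogeneous generators. Prepending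
`R` to a resolution of `I(G)` resolves `R/I(G)`, which gives the statement for the ideal. -/

theorem mem_polyGrading_iff {j : ℤ} {f : MvPolynomial V K} :
    f ∈ polyGrading V K j ↔ ∀ m, coeff m f ≠ 0 → (m.degree : ℤ) = j := by
  cases j with
  | ofNat n =>
    simp only [polyGrading, mem_homogeneousSubmodule, IsHomogeneous, IsWeightedHomogeneous]
    refine forall_congr' fun m => imp_congr_right fun _ => ?_
    rw [Finsupp.degree_eq_weight_one]
    simp [Pi.one_def]
  | negSucc n =>
    simp only [polyGrading, Submodule.mem_bot]
    constructor
    · rintro rfl m h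
      simp at h
    · intro h
      ext m
      by_contra hm
      have := h m (by simpa using hm)
      omega

/-- The homogeneous component of degree `j`, for an integer `j`. -/
noncomputable def polyComp (j : ℤ) : MvPolynomial V K →ₗ[K] MvPolynomial V K :=
  match j with
  | Int.ofNat n => homogeneousComponent n
  | Int.negSucc _ => 0

theorem coeff_polyComp (j : ℤ) (f : MvPolynomial V K) (m : V →₀ ℕ) :
    coeff m (polyComp j f) = if (m.degree : ℤ) = j then coeff m f else 0 := by
  cases j with
  | ofNat n => simp [polyComp, coeff_homogeneousComponent]
  | negSucc n =>
    rw [if_neg (by omega)]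
    simp [polyComp]

theorem polyComp_mem (j : ℤ) (f : MvPolynomial V K) : polyComp j f ∈ polyGrading V K j := by
  rw [mem_polyGrading_iff]
  intro m hm
  rw [coeff_polyComp] at hm
  by_contra h
  exact hm (if_neg h)

theorem polyComp_of_mem {i j : ℤ} {f : MvPolynomial V K} (hf : f ∈ polyGrading V K i) :
    polyComp j f = if i = j then f else 0 := by
  rw [mem_polyGrading_iff] at hf
  ext m
  rw [coeff_polyComp]
  by_cases h : coeff m f = 0
  · split_ifs <;> simp [h]
  · rw [hf m h]
    split_ifs <;> simp

theorem X_mul_mem_polyGrading {s : ℤ} {f : MvPolynomial V K} (v : V)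
    (hf : f ∈ polyGrading V K s) : X v * f ∈ polyGrading V K (s + 1) := by
  classical
  rw [mem_polyGrading_iff] at hf ⊢
  intro m hm
  rw [coeff_X_mul'] at hm
  split_ifs at hm with h
  · have h1 := hf _ hm
    have h2 : m = Finsupp.single v 1 + (m - Finsupp.single v 1) := by
      rw [add_tsub_cancel_of_le]
      simpa [Finsupp.single_le_iff, Nat.one_le_iff_ne_zero] using h
    rw [h2, map_add, Finsupp.degree_single]
    push_cast
    omega
  · exact absurd rfl hm

theorem monomial_mem_polyGrading (m : V →₀ ℕ) (a : K) :
    monomial m a ∈ polyGrading V K (m.degree : ℤ) := by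
  classical
  rw [mem_polyGrading_iff]
  intro m' h
  rw [coeff_monomial] at h
  split_ifs at h with h1
  · rw [h1]
  · exact absurd rfl h

variable {n : ℕ} {δ : Fin n → ℤ}

theorem mem_shiftedGrading_iff {j : ℤ} {x : Fin n → MvPolynomial V K} :
    x ∈ shiftedGrading V K δ j ↔ ∀ b, x b ∈ polyGrading V K (j - δ b) := by
  simp [shiftedGrading, Submodule.mem_pi]

theorem X_smul_mem_shiftedGrading {s : ℤ} {x : Fin n → MvPolynomial V K} (v : V)
    (hx : x ∈ shiftedGrading V K δ s) :
    (X v : MvPolynomial V K) • x ∈ shiftedGrading V K δ (s + 1) := by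
  rw [mem_shiftedGrading_iff] at hx ⊢
  intro b
  have := X_mul_mem_polyGrading v (hx b)
  rwa [show s + 1 - δ b = s - δ b + 1 by ring]

/-- The homogeneous component of degree `j` in the graded free module `⨁ R(-δ b)`. -/
noncomputable def shiftedComp (δ : Fin n → ℤ) (j : ℤ) :
    (Fin n → MvPolynomial V K) →ₗ[K] (Fin n → MvPolynomial V K) :=
  LinearMap.pi fun b => polyComp (j - δ b) ∘ₗ LinearMap.proj b

@[simp]
theorem shiftedComp_apply (j : ℤ) (x : Fin n → MvPolynomial V K) (b : Fin n) :
    shiftedComp δ j x b = polyComp (j - δ b) (x b) := rfl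

theorem shiftedComp_mem (j : ℤ) (x : Fin n → MvPolynomial V K) :
    shiftedComp δ j x ∈ shiftedGrading V K δ j :=
  mem_shiftedGrading_iff.2 fun _ => polyComp_mem _ _

theorem shiftedComp_of_mem {i j : ℤ} {x : Fin n → MvPolynomial V K}
    (hx : x ∈ shiftedGrading V K δ i) : shiftedComp δ j x = if i = j then x else 0 := by
  rw [mem_shiftedGrading_iff] at hx
  funext b
  rw [shiftedComp_apply, polyComp_of_mem (hx b)]
  by_cases h : i = j
  · simp [h]
  · rw [if_neg h, if_neg (by omega)]
    rfl

/-- Additive maps out of a graded free module that agree on homogeneous elements are equal. -/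
theorem eq_of_eq_on_shiftedGrading {A : Type*} [AddCommGroup A]
    {α β : (Fin n → MvPolynomial V K) →+ A}
    (h : ∀ j, ∀ x ∈ shiftedGrading V K δ j, α x = β x) : α = β := by
  refine AddMonoidHom.functions_ext _ _ _ fun b f => ?_
  induction f using MvPolynomial.induction_on' with
  | monomial m a =>
    refine h (m.degree + δ b) _ (mem_shiftedGrading_iff.2 fun b' => ?_)
    by_cases hb : b' = b
    · subst hb
      simpa using monomial_mem_polyGrading m a
    · rw [Pi.single_eq_of_ne hb]
      exact Submodule.zero_mem _
  | add p q hp hq => rw [Pi.single_add, map_add, map_add, hp, hq]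

theorem shiftedComp_comm {n' : ℕ} {δ' : Fin n' → ℤ}
    (φ : (Fin n → MvPolynomial V K) →ₗ[MvPolynomial V K] (Fin n' → MvPolynomial V K))
    (hφ : ∀ j, ∀ x ∈ shiftedGrading V K δ j, φ x ∈ shiftedGrading V K δ' j) (j : ℤ)
    (x : Fin n → MvPolynomial V K) :
    φ (shiftedComp δ j x) = shiftedComp δ' j (φ x) := by
  have := eq_of_eq_on_shiftedGrading (δ := δ)
    (α := φ.toAddMonoidHom.comp (shiftedComp δ j).toAddMonoidHom)
    (β := (shiftedComp δ' j).toAddMonoidHom.comp φ.toAddMonoidHom) ?_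
  · exact DFunLike.congr_fun this x
  · intro i y hy
    simp only [AddMonoidHom.comp_apply, LinearMap.toAddMonoidHom_coe]
    rw [shiftedComp_of_mem hy, shiftedComp_of_mem (hφ i y hy)]
    split_ifs <;> simp

end Components

/-! ### The Koszul differential -/

section Koszul

variable {V : Type*} [LinearOrder V]

/-- The sign `±1` of moving the vertex `v` to its place in front of `T`. -/
def koszulSign (v : V) (T : Finset V) : ℤ := (-1) ^ (T.filter (· < v)).card

theorem koszulSign_mul_self (v : V) (T : Finset V) : koszulSign v T * koszulSign v T = 1 := by
  rw [koszulSign, ← mul_pow]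
  simp

theorem koszulSign_insert_of_lt {u v : V} {T : Finset V} (hu : u ∉ T) (h : u < v) :
    koszulSign v (insert u T) = -koszulSign v T := by
  rw [koszulSign, koszulSign, Finset.filter_insert, if_pos h,
    Finset.card_insert_of_notMem (by simp [hu]), pow_succ]
  ring

theorem koszulSign_insert_of_gt {u v : V} {T : Finset V} (h : v < u) :
    koszulSign v (insert u T) = koszulSign v T := by
  rw [koszulSign, koszulSign, Finset.filter_insert, if_neg h.not_gt]

/-- The anticommutativity `e_u ∧ e_v = -e_v ∧ e_u` in terms of signs; every cancellation in the
Koszul complex comes from it. -/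
theorem koszulSign_mul_insert {u v : V} {T : Finset V} (hu : u ∉ T) (hv : v ∉ T) (h : u ≠ v) :
    koszulSign v T * koszulSign u (insert v T) = -(koszulSign u T * koszulSign v (insert u T)) := by
  rcases lt_or_gt_of_ne h with h | h
  · rw [koszulSign_insert_of_gt h, koszulSign_insert_of_lt hu h]
    ring
  · rw [koszulSign_insert_of_gt h, koszulSign_insert_of_lt hv h]
    ring

variable [Fintype V] {K N N' : Type*} [Field K] [AddCommGroup N] [Module (MvPolynomial V K) N]
  [AddCommGroup N'] [Module (MvPolynomial V K) N']

variable (K N) in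
/-- The differential of the Koszul complex of the variables with coefficients in `N`, on the
direct sum of all its terms: the component at `T` belongs to the basis element indexed by `T` of
the exterior algebra. -/
noncomputable def koszulD : (Finset V → N) →ₗ[MvPolynomial V K] (Finset V → N) :=
  LinearMap.pi fun T => ∑ v ∈ Tᶜ,
    koszulSign v T • (X v : MvPolynomial V K) • LinearMap.proj (insert v T)

theorem koszulD_apply (c : Finset V → N) (T : Finset V) :
    koszulD K N c T = ∑ v ∈ Tᶜ, koszulSign v T • (X v : MvPolynomial V K) • c (insert v T) := by
  simp [koszulD, LinearMap.sum_apply]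

theorem koszulD_map (f : N →ₗ[MvPolynomial V K] N') (c : Finset V → N) :
    koszulD K N' (fun T => f (c T)) = fun T => f (koszulD K N c T) := by
  funext T
  simp only [koszulD_apply, map_sum, map_zsmul, map_smul]

/-- The terms removing `v, u` and `u, v` cancel in pairs. -/
theorem koszulD_koszulD (c : Finset V → N) : koszulD K N (koszulD K N c) = 0 := by
  funext T
  simp only [koszulD_apply, Finset.smul_sum, Finset.sum_sigma', Pi.zero_apply]
  refine Finset.sum_involution (fun p _ => ⟨p.2, p.1⟩) ?_ ?_ ?_ ?_
  · rintro ⟨v, u⟩ h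
    simp only [Finset.mem_sigma, Finset.mem_compl, Finset.mem_insert, not_or] at h
    obtain ⟨hv, hne, hu⟩ := h
    dsimp only
    rw [Finset.insert_comm v u T, smul_comm (X v : MvPolynomial V K) (koszulSign u _),
      smul_comm (X u : MvPolynomial V K) (koszulSign v _),
      smul_comm (X u : MvPolynomial V K) (X v : MvPolynomial V K),
      ← mul_smul (koszulSign v T), ← mul_smul (koszulSign u T),
      koszulSign_mul_insert hu hv hne, neg_smul, neg_add_cancel]
  · rintro ⟨v, u⟩ h _ heq
    simp only [Finset.mem_sigma, Finset.mem_compl, Finset.mem_insert, not_or] at h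
    exact h.2.1 (congrArg Sigma.fst heq)
  · rintro ⟨v, u⟩ h
    simp only [Finset.mem_sigma, Finset.mem_compl, Finset.mem_insert, not_or] at h ⊢
    exact ⟨h.2.2, fun e => h.2.1 e.symm, h.1⟩
  · rintro ⟨v, u⟩ h
    rfl

/-- The differential of the Koszul complex preserves the coordinates lying in a submodule. -/
theorem koszulD_mem (P : Submodule (MvPolynomial V K) N) {c : Finset V → N} (hc : ∀ T, c T ∈ P)
    (T : Finset V) : koszulD K N c T ∈ P := by
  rw [koszulD_apply]
  exact P.sum_mem fun v _ => zsmul_mem (P.smul_mem _ (hc _)) _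

theorem koszulD_mem_grading [Module K N] {𝒩 : ℤ → Submodule K N}
    (h𝒩 : ∀ s x (v : V), x ∈ 𝒩 s → (X v : MvPolynomial V K) • x ∈ 𝒩 (s + 1)) {s : ℤ}
    {c : Finset V → N} (hc : ∀ T, c T ∈ 𝒩 s) (T : Finset V) :
    koszulD K N c T ∈ 𝒩 (s + 1) := by
  rw [koszulD_apply]
  exact Submodule.sum_mem _ fun v _ => zsmul_mem (h𝒩 _ _ _ (hc _)) _

theorem koszulD_poly_mem {s : ℤ} {c : Finset V → MvPolynomial V K}
    (hc : ∀ T, c T ∈ polyGrading V K s) (T : Finset V) :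
    koszulD K _ c T ∈ polyGrading V K (s + 1) :=
  koszulD_mem_grading (fun _ _ v hx => X_mul_mem_polyGrading v hx) hc T

theorem koszulD_free_mem {n : ℕ} {δ : Fin n → ℤ} {s : ℤ}
    {c : Finset V → Fin n → MvPolynomial V K}
    (hc : ∀ T, c T ∈ shiftedGrading V K δ s) (T : Finset V) :
    koszulD K _ c T ∈ shiftedGrading V K δ (s + 1) :=
  koszulD_mem_grading (fun _ _ v hx => X_smul_mem_shiftedGrading v hx) hc T

end Koszul

/-! ### Acyclicity of the Koszul complex of the polynomial ring -/

section Acyclic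

variable {V K : Type*} [Field K]

theorem coeff_X_mul_of_ne_zero {v : V} {m : V →₀ ℕ} (h : m v ≠ 0) (f : MvPolynomial V K) :
    coeff m (X v * f) = coeff (m - Finsupp.single v 1) f := by
  classical
  rw [coeff_X_mul', if_pos (by simpa using h)]

theorem coeff_X_mul_of_eq_zero {v : V} {m : V →₀ ℕ} (h : m v = 0) (f : MvPolynomial V K) :
    coeff m (X v * f) = 0 := by
  classical
  rw [coeff_X_mul', if_neg (by simpa using h)]

/-- The quotient in the division by the variable `x_v`. -/
noncomputable def divX (v : V) : MvPolynomial V K →ₗ[K] MvPolynomial V K where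
  toFun f := f.divMonomial (Finsupp.single v 1)
  map_add' f g := add_divMonomial f g _
  map_smul' a f := by
    ext m
    simp [coeff_divMonomial]

theorem coeff_divX (v : V) (f : MvPolynomial V K) (m : V →₀ ℕ) :
    coeff m (divX v f) = coeff (m + Finsupp.single v 1) f := by
  rw [add_comm]
  rfl

theorem coeff_sub_X_mul_divX (v : V) (f : MvPolynomial V K) (m : V →₀ ℕ) :
    coeff m (f - X v * divX v f) = if m v = 0 then coeff m f else 0 := by
  rw [coeff_sub]
  split_ifs with h
  · rw [coeff_X_mul_of_eq_zero h, sub_zero]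
  · rw [coeff_X_mul_of_ne_zero h, coeff_divX, tsub_add_cancel_of_le, sub_self]
    simpa [Finsupp.single_le_iff, Nat.one_le_iff_ne_zero] using h

theorem divX_X_mul (v : V) (f : MvPolynomial V K) : divX v (X v * f) = f := by
  ext m
  rw [coeff_divX, coeff_X_mul_of_ne_zero (by simp), add_tsub_cancel_right]

theorem divX_X_mul_of_ne {u v : V} (h : u ≠ v) (f : MvPolynomial V K) :
    divX v (X u * f) = X u * divX v f := by
  classical
  ext m
  rw [coeff_divX, coeff_X_mul', coeff_X_mul']
  have h1 : u ∈ (m + Finsupp.single v 1).support ↔ u ∈ m.support := by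
    simp [h.symm]
  simp only [h1]
  split_ifs with h2
  · rw [coeff_divX]
    congr 1
    ext w
    simp only [Finsupp.coe_tsub, Finsupp.coe_add, Pi.sub_apply, Pi.add_apply]
    have : u ∈ m.support := h2
    rw [Finsupp.mem_support_iff] at this
    by_cases hw : w = u
    · subst hw
      simp [h.symm]
    · simp [Finsupp.single_apply, Ne.symm hw]
  · rfl

theorem divX_mem_polyGrading {s : ℤ} {f : MvPolynomial V K} (v : V)
    (hf : f ∈ polyGrading V K s) : divX v f ∈ polyGrading V K (s - 1) := by
  rw [mem_polyGrading_iff] at hf ⊢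
  intro m hm
  rw [coeff_divX] at hm
  have := hf _ hm
  rw [map_add, Finsupp.degree_single] at this
  push_cast at this
  omega

variable [LinearOrder V]

/-- The contracting homotopy of the Koszul complex in the direction of the variable `x_v`. -/
noncomputable def koszulHomotopy (v : V) (c : Finset V → MvPolynomial V K) :
    Finset V → MvPolynomial V K :=
  fun T => if v ∈ T then koszulSign v (T.erase v) • divX v (c (T.erase v)) else 0

theorem koszulHomotopy_apply_insert (v : V) (c : Finset V → MvPolynomial V K) {T : Finset V}
    (hv : v ∉ T) : koszulHomotopy v c (insert v T) = koszulSign v T • divX v (c T) := by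
  rw [koszulHomotopy, if_pos (Finset.mem_insert_self v T), Finset.erase_insert hv]

theorem koszulHomotopy_apply_of_notMem (v : V) (c : Finset V → MvPolynomial V K) {T : Finset V}
    (hv : v ∉ T) : koszulHomotopy v c T = 0 := if_neg hv

variable [Fintype V]

theorem koszulD_homotopy_of_notMem (v : V) (c : Finset V → MvPolynomial V K) {T : Finset V}
    (hv : v ∉ T) : koszulD K _ (koszulHomotopy v c) T = X v * divX v (c T) := by
  rw [koszulD_apply, Finset.sum_eq_single v]
  · rw [koszulHomotopy_apply_insert v c hv, smul_comm (X v : MvPolynomial V K), ← mul_smul,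
      koszulSign_mul_self, one_smul, smul_eq_mul]
  · intro u _ hu
    rw [koszulHomotopy_apply_of_notMem, smul_zero, smul_zero]
    simp [hv, hu.symm]
  · intro h
    simp [hv] at h

/-- On cycles, `1 - d h` is the projection setting both `x_v` and `e_v` to zero. This is its
vanishing on the coordinates containing `v`; `koszulD_homotopy_of_notMem` describes the others. -/
theorem koszulD_homotopy_insert (v : V) {c : Finset V → MvPolynomial V K} (hc : koszulD K _ c = 0)
    {T : Finset V} (hv : v ∉ T) :
    koszulD K _ (koszulHomotopy v c) (insert v T) = c (insert v T) := by
  have h0 : koszulSign v T • divX v (koszulD K _ c T) = 0 := by rw [hc]; simp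
  have hT : Tᶜ = insert v (insert v T)ᶜ := by
    ext u
    by_cases h : u = v
    · simp [h, hv]
    · simp [h]
  rw [koszulD_apply, hT, Finset.sum_insert (by simp), map_add, smul_add, smul_eq_mul, map_zsmul,
    divX_X_mul, ← mul_smul, koszulSign_mul_self, one_smul] at h0
  rw [koszulD_apply, eq_neg_of_add_eq_zero_left h0, map_sum, Finset.smul_sum,
    ← Finset.sum_neg_distrib]
  refine Finset.sum_congr rfl fun u hu => ?_
  simp only [Finset.mem_compl, Finset.mem_insert, not_or] at hu
  obtain ⟨hne, hu⟩ := hu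
  rw [Finset.insert_comm u v T, koszulHomotopy_apply_insert v c (by simp [hv, Ne.symm hne]),
    smul_comm (X u : MvPolynomial V K), ← mul_smul, map_zsmul, smul_eq_mul, smul_eq_mul,
    divX_X_mul_of_ne hne, ← mul_smul, ← neg_smul]
  congr 1
  have h1 := koszulSign_mul_insert hu hv hne
  have h2 := koszulSign_mul_self v T
  have h3 := koszulSign_mul_self v (insert u T)
  linear_combination (koszulSign v T * koszulSign v (insert u T)) * h1 -
    (koszulSign v (insert u T) * koszulSign u (insert v T)) * h2 -
    (koszulSign v T * koszulSign u T) * h3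

/-- A homogeneous Koszul cycle is homologous to one that does not involve a given set of
variables. -/
theorem exists_koszulD_sub_free {s : ℤ} {c : Finset V → MvPolynomial V K}
    (hc : ∀ T, c T ∈ polyGrading V K s) (hd : koszulD K _ c = 0) (S : Finset V) :
    ∃ b : Finset V → MvPolynomial V K, (∀ T, b T ∈ polyGrading V K (s - 1)) ∧
      ∀ T, ∀ v ∈ S, (v ∈ T → (c - koszulD K _ b) T = 0) ∧
        ∀ m : V →₀ ℕ, m v ≠ 0 → coeff m ((c - koszulD K _ b) T) = 0 := by
  induction S using Finset.induction_on with
  | empty => exact ⟨0, fun T => Submodule.zero_mem _, by simp⟩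
  | insert v S hv ih =>
    obtain ⟨b, hb, hS⟩ := ih
    set e := c - koszulD K _ b with he
    have hed : koszulD K _ e = 0 := by rw [he, map_sub, hd, koszulD_koszulD, sub_zero]
    have hes : ∀ T, e T ∈ polyGrading V K s := fun T => by
      have := koszulD_poly_mem hb T
      rw [sub_add_cancel] at this
      exact Submodule.sub_mem _ (hc T) this
    -- Removing `x_v` from `e` only discards coordinates and monomials, so the variables removed
    -- earlier do not come back.
    refine ⟨b + koszulHomotopy v e, fun T => ?_, ?_⟩
    · refine Submodule.add_mem _ (hb T) ?_
      rw [koszulHomotopy]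
      split_ifs
      · exact zsmul_mem (divX_mem_polyGrading v (hes _)) _
      · exact Submodule.zero_mem _
    · rw [map_add, ← sub_sub, ← he]
      have hin : ∀ T, v ∈ T → (e - koszulD K _ (koszulHomotopy v e)) T = 0 := by
        intro T hT
        have := koszulD_homotopy_insert v hed (Finset.notMem_erase v T)
        rw [Finset.insert_erase hT] at this
        rw [Pi.sub_apply, this, sub_self]
      have hco : ∀ T, v ∉ T → ∀ m, coeff m ((e - koszulD K _ (koszulHomotopy v e)) T) =
          if m v = 0 then coeff m (e T) else 0 := by
        intro T hT m
        rw [Pi.sub_apply, koszulD_homotopy_of_notMem v e hT, coeff_sub_X_mul_divX]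
      intro T u hu
      by_cases hT : v ∈ T
      · rw [hin T hT]
        simp
      · rcases Finset.mem_insert.1 hu with rfl | hu
        · refine ⟨fun h => absurd h hT, fun m hm => ?_⟩
          rw [hco T hT, if_neg hm]
        · refine ⟨fun h => ?_, fun m hm => ?_⟩
          · ext m
            rw [hco T hT, (hS T u hu).1 h]
            simp
          · rw [hco T hT, (hS T u hu).2 m hm]
            simp

theorem constantCoeff_koszulD (b : Finset V → MvPolynomial V K) (T : Finset V) :
    constantCoeff (koszulD K _ b T) = 0 := by
  rw [koszulD_apply, map_sum]
  refine Finset.sum_eq_zero fun v _ => ?_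
  rw [map_zsmul, smul_eq_mul, map_mul, constantCoeff_X, zero_mul, smul_zero]

/-- The Koszul complex of the polynomial ring is exact, except for the constants at `∅`. -/
theorem exists_koszulD_eq_poly {s : ℤ} {c : Finset V → MvPolynomial V K}
    (hc : ∀ T, c T ∈ polyGrading V K s) (hd : koszulD K _ c = 0)
    (h0 : constantCoeff (c ∅) = 0) :
    ∃ b : Finset V → MvPolynomial V K, (∀ T, b T ∈ polyGrading V K (s - 1)) ∧
      koszulD K _ b = c := by
  obtain ⟨b, hb, h⟩ := exists_koszulD_sub_free hc hd Finset.univ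
  refine ⟨b, hb, ?_⟩
  rw [eq_comm, ← sub_eq_zero]
  funext T
  by_cases hT : T = ∅
  · subst hT
    ext m
    by_cases hm : m = 0
    · subst hm
      have : constantCoeff ((c - koszulD K _ b) ∅) = 0 := by
        rw [Pi.sub_apply, map_sub, h0, constantCoeff_koszulD, sub_zero]
      exact this
    · obtain ⟨v, hv⟩ : ∃ v, m v ≠ 0 := by
        by_contra! h
        exact hm (Finsupp.ext h)
      rw [(h ∅ v (Finset.mem_univ v)).2 m hv]
      simp
  · obtain ⟨v, hv⟩ := Finset.nonempty_iff_ne_empty.2 hT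
    exact (h T v (Finset.mem_univ v)).1 hv

theorem exists_koszulD_eq_free {n : ℕ} {δ : Fin n → ℤ} {s : ℤ}
    {c : Finset V → Fin n → MvPolynomial V K} (hc : ∀ T, c T ∈ shiftedGrading V K δ s)
    (hd : koszulD K _ c = 0) (h0 : ∀ i, constantCoeff (c ∅ i) = 0) :
    ∃ b : Finset V → Fin n → MvPolynomial V K, (∀ T, b T ∈ shiftedGrading V K δ (s - 1)) ∧
      koszulD K _ b = c := by
  have key : ∀ i, ∃ b : Finset V → MvPolynomial V K,
      (∀ T, b T ∈ polyGrading V K (s - δ i - 1)) ∧ koszulD K _ b = fun T => c T i := by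
    intro i
    refine exists_koszulD_eq_poly (fun T => mem_shiftedGrading_iff.1 (hc T) i) ?_ (h0 i)
    have := koszulD_map (K := K) (LinearMap.proj (R := MvPolynomial V K)
      (φ := fun _ : Fin n => MvPolynomial V K) i) c
    rw [hd] at this
    exact this
  choose b hb hbd using key
  refine ⟨fun T i => b i T, fun T => mem_shiftedGrading_iff.2 fun i => ?_, ?_⟩
  · rw [show s - 1 - δ i = s - δ i - 1 by ring]
    exact hb i T
  · funext T i
    have := koszulD_map (K := K) (LinearMap.proj (R := MvPolynomial V K)
      (φ := fun _ : Fin n => MvPolynomial V K) i) (fun T i => b i T)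
    have h1 := congrFun (this.symm.trans (hbd i)) T
    exact h1

end Acyclic

/-! ### Koszul homology and graded Betti numbers -/

section Syzygies

variable {V K : Type*} [Field K]

theorem constantCoeff_eq_zero_of_mem_idealOfVars {f : MvPolynomial V K}
    (hf : f ∈ idealOfVars V K) : constantCoeff f = 0 := by
  have : idealOfVars V K ≤ RingHom.ker (constantCoeff (σ := V) (R := K)) := by
    rw [idealOfVars, Ideal.span_le]
    rintro _ ⟨v, rfl⟩
    simp
  exact this hf

variable {M : Type*} [AddCommGroup M] [Module K M] [Module (MvPolynomial V K) M]
  {ℳ : ℤ → Submodule K M} (F : MinimalGradedFreeResolution (V := V) ℳ)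

/-- The homogeneous elements of the image of the differential `F_{i+1} → F_i`. -/
def MinimalGradedFreeResolution.syzygies (i : ℕ) (j : ℤ) :
    Set (Fin (F.rank i) → MvPolynomial V K) :=
  {x | x ∈ shiftedGrading V K (F.deg i) j ∧ x ∈ LinearMap.range (F.d i)}

/-- Since `d` commutes with homogeneous components, the component of any preimage of a homogeneous
element is a homogeneous preimage. -/
theorem MinimalGradedFreeResolution.image_d (i : ℕ) (j : ℤ) :
    F.d i '' (shiftedGrading V K (F.deg (i + 1)) j : Set _) = F.syzygies i j := by
  ext x
  constructor
  · rintro ⟨y, hy, rfl⟩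
    exact ⟨F.d_homogeneous i j y hy, y, rfl⟩
  · rintro ⟨hx, y, rfl⟩
    refine ⟨shiftedComp (F.deg (i + 1)) j y, shiftedComp_mem _ _, ?_⟩
    rw [shiftedComp_comm (F.d i) (F.d_homogeneous i), shiftedComp_of_mem hx, if_pos rfl]

theorem MinimalGradedFreeResolution.syzygies_zero :
    F.syzygies 0 = fun j => {x | x ∈ shiftedGrading V K (F.deg 0) j ∧ F.ε x = 0} := by
  funext j
  ext x
  exact and_congr_right fun _ => (F.exact_zero x).symm

theorem MinimalGradedFreeResolution.syzygies_succ (i : ℕ) :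
    F.syzygies (i + 1) =
      fun j => {x | x ∈ shiftedGrading V K (F.deg (i + 1)) j ∧ F.d i x = 0} := by
  funext j
  ext x
  exact and_congr_right fun _ => (F.exact_succ i x).symm

theorem MinimalGradedFreeResolution.mem_idealOfVars_of_ε_eq_zero
    (x : Fin (F.rank 0) → MvPolynomial V K) (hx : F.ε x = 0) (b : Fin (F.rank 0)) :
    x b ∈ idealOfVars V K := by
  obtain ⟨y, rfl⟩ := (F.exact_zero x).1 hx
  exact F.minimal 0 y b

theorem MinimalGradedFreeResolution.mem_idealOfVars_of_d_eq_zero (i : ℕ)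
    (x : Fin (F.rank (i + 1)) → MvPolynomial V K) (hx : F.d i x = 0) (b : Fin (F.rank (i + 1))) :
    x b ∈ idealOfVars V K := by
  obtain ⟨y, rfl⟩ := (F.exact_succ i x).1 hx
  exact F.minimal _ y b

end Syzygies

/-! ### Exact Koszul strands and vanishing Betti numbers -/

section Betti

variable (V : Type*) (K : Type*) [Field K] [Fintype V] [LinearOrder V]

/-- The strand of internal degree `s` of the Koszul complex of a graded module, which consists of
the chains with coefficients of degree `s`, is exact. -/
def KoszulExact {N : Type*} [AddCommGroup N] [Module (MvPolynomial V K) N] (𝒩 : ℤ → Set N)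
    (s : ℤ) : Prop :=
  ∀ c : Finset V → N, (∀ T, c T ∈ 𝒩 s) → koszulD K N c = 0 →
    ∃ b : Finset V → N, (∀ T, b T ∈ 𝒩 (s - 1)) ∧ koszulD K N b = c

/-- Exactness of a strand of the Koszul complex in homological degrees less than `k`. -/
def KoszulExactBelow {N : Type*} [AddCommGroup N] [Module (MvPolynomial V K) N] (𝒩 : ℤ → Set N)
    (k : ℕ) (s : ℤ) : Prop :=
  ∀ c : Finset V → N, (∀ T, c T ∈ 𝒩 s) → (∀ T, k ≤ T.card → c T = 0) → koszulD K N c = 0 →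
    ∃ b : Finset V → N, (∀ T, b T ∈ 𝒩 (s - 1)) ∧ koszulD K N b = c

variable {V K}

variable {N : Type*} [AddCommGroup N] [Module (MvPolynomial V K) N] {𝒩 : ℤ → Set N} {n : ℕ}
  {δ : Fin n → ℤ} {ε : (Fin n → MvPolynomial V K) →ₗ[MvPolynomial V K] N}

theorem KoszulExactBelow.koszulExact {s : ℤ}
    (h : KoszulExactBelow V K 𝒩 (Fintype.card V + 1) s) : KoszulExact V K 𝒩 s :=
  fun c hc hd => h c hc (fun T hT => by have := Finset.card_le_univ T; omega) hd

/-- Koszul homology at `∅` is `N/𝔪N`. A basis vector of degree `s` gives a cycle there; bounding it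
would put the basis vector into `𝔪F + ker ε = 𝔪F`. -/
theorem KoszulExact.deg_ne
    (hε : ∀ j, ε '' (shiftedGrading V K δ j : Set (Fin n → MvPolynomial V K)) = 𝒩 j)
    (hmin : ∀ x, ε x = 0 → ∀ b, x b ∈ idealOfVars V K) {s : ℤ} (h : KoszulExact V K 𝒩 s)
    (b : Fin n) : δ b ≠ s := by
  rintro rfl
  have h0 : ∀ j, (0 : N) ∈ 𝒩 j := fun j => hε j ▸ ⟨0, Submodule.zero_mem _, map_zero _⟩
  have hb : (Pi.single b 1 : Fin n → MvPolynomial V K) ∈ shiftedGrading V K δ (δ b) := by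
    refine mem_shiftedGrading_iff.2 fun b' => ?_
    by_cases hb : b' = b
    · subst hb
      simpa using monomial_mem_polyGrading (0 : V →₀ ℕ) (1 : K)
    · rw [Pi.single_eq_of_ne hb]
      exact Submodule.zero_mem _
  obtain ⟨a, ha, had⟩ := h (fun T => if T = ∅ then ε (Pi.single b 1) else 0) (fun T => by
    split_ifs
    · exact hε _ ▸ ⟨_, hb, rfl⟩
    · exact h0 _) (by
    funext T
    rw [koszulD_apply]
    exact Finset.sum_eq_zero fun v _ => by simp)
  have ha' : ∀ T, ∃ x, ε x = a T := fun T => by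
    have := ha T
    rw [← hε] at this
    obtain ⟨x, -, hx⟩ := this
    exact ⟨x, hx⟩
  choose g hg using ha'
  have h1 := congrFun had ∅
  obtain rfl : (fun T => ε (g T)) = a := funext hg
  rw [koszulD_map, if_pos rfl, ← sub_eq_zero, ← map_sub] at h1
  have h2 := constantCoeff_eq_zero_of_mem_idealOfVars (hmin _ h1 b)
  have h3 : koszulD K _ g ∅ b = koszulD K _ (fun T => g T b) ∅ :=
    (congrFun (koszulD_map (K := K) (LinearMap.proj (R := MvPolynomial V K)
      (φ := fun _ : Fin n => MvPolynomial V K) b) g) ∅).symm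
  rw [Pi.sub_apply, map_sub, h3, constantCoeff_koszulD, Pi.single_eq_same] at h2
  simp at h2

/-- A cycle with coefficients in `ker ε` bounds some `b` in the free module. Then `ε b` is a cycle
one degree lower, hence a boundary, and subtracting a lift of it moves `b` into `ker ε`. -/
theorem KoszulExact.syzygy
    (hε : ∀ j, ε '' (shiftedGrading V K δ j : Set (Fin n → MvPolynomial V K)) = 𝒩 j)
    (hmin : ∀ x, ε x = 0 → ∀ b, x b ∈ idealOfVars V K) {s : ℤ} (h : KoszulExact V K 𝒩 s) :
    KoszulExact V K (fun j => {x | x ∈ shiftedGrading V K δ j ∧ ε x = 0}) (s + 1) := by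
  intro c hc hd
  obtain ⟨b, hb, rfl⟩ := exists_koszulD_eq_free (fun T => (hc T).1) hd
    fun i => constantCoeff_eq_zero_of_mem_idealOfVars (hmin _ (hc ∅).2 i)
  rw [add_sub_cancel_right] at hb ⊢
  obtain ⟨a, ha, had⟩ := h (fun T => ε (b T)) (fun T => hε s ▸ ⟨_, hb T, rfl⟩) (by
    rw [koszulD_map]
    funext T
    exact (hc T).2)
  simp_rw [← hε] at ha
  choose g hg hga using ha
  obtain rfl : (fun T => ε (g T)) = a := funext hga
  refine ⟨b - koszulD K _ g, fun T => ⟨?_, ?_⟩, ?_⟩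
  · refine Submodule.sub_mem _ (hb T) ?_
    have := koszulD_free_mem hg T
    rwa [sub_add_cancel] at this
  · rw [koszulD_map] at had
    rw [Pi.sub_apply, map_sub, sub_eq_zero]
    exact (congrFun had T).symm
  · rw [map_sub, koszulD_koszulD, sub_zero]

/-- Converse shift. If `g` lifts a cycle, then `d g` is a cycle of syzygies of homological degree
one lower; bounding it by `b` makes `g - b` a cycle of the free module. The bound `k` makes an
induction possible, starting at `k = 0`, where the only chain is zero. -/
theorem KoszulExactBelow.of_syzygy
    (hε : ∀ j, ε '' (shiftedGrading V K δ j : Set (Fin n → MvPolynomial V K)) = 𝒩 j)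
    {s : ℤ} {k : ℕ} (hs : ∀ b, δ b ≠ s)
    (h : KoszulExactBelow V K (fun j => {x | x ∈ shiftedGrading V K δ j ∧ ε x = 0}) k (s + 1)) :
    KoszulExactBelow V K 𝒩 (k + 1) s := by
  intro c hc hk hd
  have : ∀ T, ∃ x, x ∈ shiftedGrading V K δ s ∧ ε x = c T ∧ (k + 1 ≤ T.card → x = 0) := by
    intro T
    by_cases hT : k + 1 ≤ T.card
    · exact ⟨0, Submodule.zero_mem _, by rw [map_zero, hk T hT], fun _ => rfl⟩
    · have := hc T
      rw [← hε] at this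
      obtain ⟨x, hx, hxc⟩ := this
      exact ⟨x, hx, hxc, fun h => absurd h hT⟩
  choose g hg hgc hgk using this
  obtain rfl : (fun T => ε (g T)) = c := funext hgc
  obtain ⟨b, hb, hbd⟩ := h (koszulD K _ g) (fun T => ⟨koszulD_free_mem hg T, by
      rw [koszulD_map] at hd
      exact congrFun hd T⟩) (fun T hT => by
      rw [koszulD_apply]
      refine Finset.sum_eq_zero fun v hv => ?_
      rw [hgk _ (by rw [Finset.card_insert_of_notMem (by simpa using hv)]; omega), smul_zero,
        smul_zero]) (koszulD_koszulD g)
  rw [add_sub_cancel_right] at hb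
  obtain ⟨a, ha, had⟩ := exists_koszulD_eq_free (c := g - b) (δ := δ) (s := s)
    -- The constants are the only obstruction in the free module, and they occur in degree `s` only
    -- if a generator has degree `s`.
    (fun T => Submodule.sub_mem _ (hg T) (hb T).1) (by rw [map_sub, hbd, sub_self]) (fun i => by
      have h1 := mem_shiftedGrading_iff.1 (Submodule.sub_mem _ (hg ∅) (hb ∅).1) i
      by_contra h2
      have h3 := mem_polyGrading_iff.1 h1 0 h2
      refine hs i ?_
      simp only [map_zero, Nat.cast_zero] at h3
      omega)
  refine ⟨fun T => ε (a T), fun T => hε _ ▸ ⟨_, ha T, rfl⟩, ?_⟩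
  rw [koszulD_map, had]
  funext T
  rw [Pi.sub_apply, map_sub, (hb T).2, sub_zero]

variable {M : Type*} [AddCommGroup M] [Module K M] [Module (MvPolynomial V K) M]
  {ℳ : ℤ → Submodule K M} {F : MinimalGradedFreeResolution (V := V) ℳ}

theorem MinimalGradedFreeResolution.koszulExact_syzygies
    (hF : ∀ j, F.ε '' (shiftedGrading V K (F.deg 0) j : Set _) = (ℳ j : Set M))
    {s : ℤ}
    (h : KoszulExact V K (fun j => (ℳ j : Set M)) s) (i : ℕ) :
    KoszulExact V K (F.syzygies i) (s + i + 1) := by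
  induction i with
  | zero =>
    rw [F.syzygies_zero]
    simpa using h.syzygy hF F.mem_idealOfVars_of_ε_eq_zero
  | succ i ih =>
    rw [F.syzygies_succ]
    have := ih.syzygy (F.image_d i) (F.mem_idealOfVars_of_d_eq_zero i)
    push_cast
    rwa [← add_assoc]

/-- If the strand `s` of the Koszul complex is exact, the Betti numbers `β_{i,i+s}` vanish. -/
theorem MinimalGradedFreeResolution.deg_ne_of_koszulExact
    (hF : ∀ j, F.ε '' (shiftedGrading V K (F.deg 0) j : Set _) = (ℳ j : Set M))
    {s : ℤ}
    (h : KoszulExact V K (fun j => (ℳ j : Set M)) s) (i : ℕ) (b : Fin (F.rank i)) :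
    F.deg i b ≠ s + i := by
  cases i with
  | zero => simpa using h.deg_ne hF F.mem_idealOfVars_of_ε_eq_zero b
  | succ i =>
    have := (koszulExact_syzygies hF h i).deg_ne (F.image_d i)
      (F.mem_idealOfVars_of_d_eq_zero i) b
    push_cast
    rwa [← add_assoc]

/-- If the Betti numbers `β_{i,i+s}` vanish, the strand `s` of the Koszul complex is exact. -/
theorem MinimalGradedFreeResolution.koszulExact_of_deg_ne
    (hF : ∀ j, F.ε '' (shiftedGrading V K (F.deg 0) j : Set _) = (ℳ j : Set M))
    {s : ℤ}
    (h : ∀ (i : ℕ) (b : Fin (F.rank i)), F.deg i b ≠ s + i) :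
    KoszulExact V K (fun j => (ℳ j : Set M)) s := by
  have key : ∀ (k i : ℕ), KoszulExactBelow V K (F.syzygies i) k (s + i + 1) := by
    intro k
    induction k with
    | zero =>
      intro i c _ hk _
      obtain rfl : c = 0 := funext fun T => hk T (Nat.zero_le _)
      exact ⟨0, fun T => ⟨Submodule.zero_mem _, Submodule.zero_mem _⟩, map_zero _⟩
    | succ k ih =>
      intro i
      refine KoszulExactBelow.of_syzygy (F.image_d i) (fun b => ?_) ?_
      · have := h (i + 1) b
        push_cast at this
        rwa [← add_assoc] at this
      · rw [← F.syzygies_succ]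
        have := ih (i + 1)
        push_cast at this
        rwa [← add_assoc] at this
  refine (KoszulExactBelow.of_syzygy hF (fun b => ?_) ?_ : KoszulExactBelow V K _ _ s).koszulExact
  · simpa using h 0 b
  · rw [← F.syzygies_zero]
    simpa using key _ 0

end Betti

/-! ### Monomial ideals attached to induced subgraphs -/

section RestrictedIdeal

variable {V : Type*} (K : Type*) [Field K] (G : SimpleGraph V)

/-- The exponents of the monomials in the ideal generated by the variables outside `W` and the
edges of `G` inside `W`. -/
def IsRestrictedExponent (W : Finset V) (m : V →₀ ℕ) : Prop :=
  (∃ v ∉ W, m v ≠ 0) ∨ ∃ u ∈ W, ∃ v ∈ W, G.Adj u v ∧ m u ≠ 0 ∧ m v ≠ 0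

variable {G} in
theorem IsRestrictedExponent.mono {W : Finset V} {m m' : V →₀ ℕ} (h : IsRestrictedExponent G W m)
    (hm : ∀ v, m v ≠ 0 → m' v ≠ 0) : IsRestrictedExponent G W m' := by
  rcases h with ⟨v, hv, h⟩ | ⟨u, hu, v, hv, huv, h1, h2⟩
  · exact Or.inl ⟨v, hv, hm v h⟩
  · exact Or.inr ⟨u, hu, v, hv, huv, hm u h1, hm v h2⟩

/-- The ideal of the polynomial ring generated by the variables outside `W` and the edges of `G`
inside `W`; the quotient is the quotient by the edge ideal of the induced subgraph on `W`. -/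
def restrictedIdeal (W : Finset V) : Ideal (MvPolynomial V K) where
  carrier := {f | ∀ m, coeff m f ≠ 0 → IsRestrictedExponent G W m}
  add_mem' {f g} hf hg m hm := by
    by_cases h : coeff m f = 0
    · refine hg m fun h' => hm ?_
      rw [coeff_add, h, h', add_zero]
    · exact hf m h
  zero_mem' m hm := absurd (coeff_zero m) hm
  smul_mem' g f hf := by
    simp only [Set.mem_ofPred_eq, smul_eq_mul] at hf ⊢
    induction g using MvPolynomial.induction_on with
    | C a =>
      intro m hm
      rw [coeff_C_mul] at hm
      exact hf m (right_ne_zero_of_mul hm)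
    | add p q hp hq =>
      intro m hm
      rw [add_mul, coeff_add] at hm
      by_cases h : coeff m (p * f) = 0
      · exact hq m fun h' => hm (by rw [h, h', add_zero])
      · exact hp m h
    | mul_X p v hp =>
      intro m hm
      rw [mul_comm p, mul_assoc] at hm
      by_cases h : m v = 0
      · exact absurd (coeff_X_mul_of_eq_zero h _) hm
      · rw [coeff_X_mul_of_ne_zero h] at hm
        refine (hp _ hm).mono fun u hu h' => hu ?_
        simp [h']

variable {K G}

theorem mem_restrictedIdeal {W : Finset V} {f : MvPolynomial V K} :
    f ∈ restrictedIdeal K G W ↔ ∀ m, coeff m f ≠ 0 → IsRestrictedExponent G W m := Iff.rfl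

theorem X_mul_mem_restrictedIdeal_iff {W : Finset V} {x : V} {f : MvPolynomial V K} :
    X x * f ∈ restrictedIdeal K G W ↔
      ∀ m, coeff m f ≠ 0 → IsRestrictedExponent G W (m + Finsupp.single x 1) := by
  rw [mem_restrictedIdeal]
  constructor
  · intro h m hm
    refine h _ ?_
    rwa [coeff_X_mul_of_ne_zero (by simp), add_tsub_cancel_right]
  · intro h m hm
    by_cases hx : m x = 0
    · exact absurd (coeff_X_mul_of_eq_zero hx _) hm
    · rw [coeff_X_mul_of_ne_zero hx] at hm
      have := h _ hm
      rwa [tsub_add_cancel_of_le] at this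
      simpa [Finsupp.single_le_iff, Nat.one_le_iff_ne_zero] using hx

theorem restrictedIdeal_congr {G' : SimpleGraph V} {W : Finset V}
    (h : ∀ u ∈ W, ∀ v ∈ W, G.Adj u v ↔ G'.Adj u v) :
    restrictedIdeal K G W = restrictedIdeal K G' W := by
  ext f
  refine forall_congr' fun m => imp_congr_right fun _ => or_congr_right ?_
  constructor
  · rintro ⟨u, hu, v, hv, huv, h1⟩
    exact ⟨u, hu, v, hv, (h u hu v hv).1 huv, h1⟩
  · rintro ⟨u, hu, v, hv, huv, h1⟩
    exact ⟨u, hu, v, hv, (h u hu v hv).2 huv, h1⟩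

theorem edgeIdeal_eq_restrictedIdeal [Fintype V] :
    edgeIdeal K G = restrictedIdeal K G Finset.univ := by
  classical
  have : {f : MvPolynomial V K | ∃ u v : V, G.Adj u v ∧ f = X u * X v} =
      (fun m => monomial m (1 : K)) ''
        {m | ∃ u v : V, G.Adj u v ∧ m = Finsupp.single u 1 + Finsupp.single v 1} := by
    ext f
    constructor
    · rintro ⟨u, v, huv, rfl⟩
      exact ⟨_, ⟨u, v, huv, rfl⟩, by simp [X, monomial_mul]⟩
    · rintro ⟨_, ⟨u, v, huv, rfl⟩, rfl⟩
      exact ⟨u, v, huv, by simp [X, monomial_mul]⟩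
  ext f
  rw [edgeIdeal, this, mem_ideal_span_monomial_image, mem_restrictedIdeal]
  refine forall_congr' fun m => ?_
  rw [mem_support_iff]
  refine imp_congr_right fun _ => ?_
  constructor
  · rintro ⟨_, ⟨u, v, huv, rfl⟩, hle⟩
    refine Or.inr ⟨u, Finset.mem_univ u, v, Finset.mem_univ v, huv, ?_, ?_⟩
    · have := hle u
      simp at this
      omega
    · have := hle v
      simp at this
      omega
  · rintro (⟨v, hv, -⟩ | ⟨u, -, v, -, huv, hu, hv⟩)
    · exact absurd (Finset.mem_univ v) hv
    · refine ⟨_, ⟨u, v, huv, rfl⟩, fun w => ?_⟩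
      by_cases h1 : u = w
      · subst h1
        simp [huv.ne']
        omega
      · by_cases h2 : v = w
        · subst h2
          simp [huv.ne]
          omega
        · simp [h1, h2]

variable [DecidableEq V]

/-- The colon ideal by `x`: each neighbour `w` of `x` becomes a generator because `x_x x_w` is in
the ideal. The vertex `x` itself stays in the filtered set, now isolated. -/
theorem X_mul_mem_restrictedIdeal_iff_filter [DecidableRel G.Adj] {W : Finset V} {x : V}
    (hx : x ∈ W) {f : MvPolynomial V K} :
    X x * f ∈ restrictedIdeal K G W ↔ f ∈ restrictedIdeal K G (W.filter (¬G.Adj x ·)) := by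
  rw [X_mul_mem_restrictedIdeal_iff, mem_restrictedIdeal]
  refine forall_congr' fun m => imp_congr_right fun _ => ?_
  have hne : ∀ w, (m + Finsupp.single x 1 : V →₀ ℕ) w ≠ 0 ↔ m w ≠ 0 ∨ w = x := by
    intro w
    by_cases h : w = x
    · simp [h]
    · simp [h]
  unfold IsRestrictedExponent
  simp only [hne, Finset.mem_filter]
  constructor
  · rintro (⟨v, hv, h | rfl⟩ | ⟨u, hu, v, hv, huv, h1, h2⟩)
    · exact Or.inl ⟨v, fun h' => hv h'.1, h⟩
    · exact absurd hx hv
    · rcases h1 with h1 | rfl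
      · rcases h2 with h2 | rfl
        · by_cases hu' : G.Adj x u
          · exact Or.inl ⟨u, fun h => h.2 hu', h1⟩
          · by_cases hv' : G.Adj x v
            · exact Or.inl ⟨v, fun h => h.2 hv', h2⟩
            · exact Or.inr ⟨u, ⟨hu, hu'⟩, v, ⟨hv, hv'⟩, huv, h1, h2⟩
        · exact Or.inl ⟨u, fun h => h.2 huv.symm, h1⟩
      · rcases h2 with h2 | rfl
        · exact Or.inl ⟨v, fun h => h.2 huv, h2⟩
        · exact absurd rfl huv.ne
  · rintro (⟨v, hv, h⟩ | ⟨u, hu, v, hv, huv, h1, h2⟩)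
    · by_cases hvW : v ∈ W
      · have : G.Adj x v := by
          by_contra h'
          exact hv ⟨hvW, h'⟩
        exact Or.inr ⟨x, hx, v, hvW, this, Or.inr rfl, Or.inl h⟩
      · exact Or.inl ⟨v, hvW, Or.inl h⟩
    · exact Or.inr ⟨u, hu.1, v, hv.1, huv, Or.inl h1, Or.inl h2⟩

theorem IsRestrictedExponent.erase {W : Finset V} {m : V →₀ ℕ} (h : IsRestrictedExponent G W m)
    (x : V) : IsRestrictedExponent G (W.erase x) m := by
  rcases h with ⟨v, hv, h⟩ | ⟨u, hu, v, hv, huv, h1, h2⟩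
  · exact Or.inl ⟨v, fun h' => hv (Finset.mem_of_mem_erase h'), h⟩
  · by_cases hux : u = x
    · exact Or.inl ⟨u, fun h => Finset.ne_of_mem_erase h hux, h1⟩
    · by_cases hvx : v = x
      · exact Or.inl ⟨v, fun h => Finset.ne_of_mem_erase h hvx, h2⟩
      · exact Or.inr ⟨u, Finset.mem_erase.2 ⟨hux, hu⟩, v, Finset.mem_erase.2 ⟨hvx, hv⟩, huv, h1, h2⟩

theorem IsRestrictedExponent.of_erase {W : Finset V} {m : V →₀ ℕ} {x : V}
    (h : IsRestrictedExponent G (W.erase x) m) (hx : m x = 0) : IsRestrictedExponent G W m := by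
  rcases h with ⟨v, hv, h⟩ | ⟨u, hu, v, hv, huv, h1, h2⟩
  · refine Or.inl ⟨v, fun h' => hv (Finset.mem_erase.2 ⟨?_, h'⟩), h⟩
    rintro rfl
    exact h hx
  · exact Or.inr ⟨u, Finset.mem_of_mem_erase hu, v, Finset.mem_of_mem_erase hv, huv, h1, h2⟩

theorem restrictedIdeal_le_erase (W : Finset V) (x : V) :
    restrictedIdeal K G W ≤ restrictedIdeal K G (W.erase x) :=
  fun _ hf m hm => (hf m hm).erase x

/-- An element of `J + (x)` is a multiple of `x` modulo `J`, with the quotient given by `divX`,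
which respects degrees. -/
theorem sub_X_mul_divX_mem_restrictedIdeal {W : Finset V} {x : V} {f : MvPolynomial V K}
    (hf : f ∈ restrictedIdeal K G (W.erase x)) : f - X x * divX x f ∈ restrictedIdeal K G W := by
  intro m hm
  rw [coeff_sub_X_mul_divX] at hm
  split_ifs at hm with h
  · exact (hf m hm).of_erase h
  · exact absurd rfl hm

theorem X_mem_restrictedIdeal_erase (W : Finset V) (x : V) :
    (X x : MvPolynomial V K) ∈ restrictedIdeal K G (W.erase x) := by
  intro m hm
  rw [coeff_X] at hm
  split_ifs at hm with h
  · subst h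
    exact Or.inl ⟨x, by simp, by simp⟩
  · exact absurd rfl hm

end RestrictedIdeal

/-! ### Vanishing of Koszul homology of quotient rings -/

section QuotientExact

variable {V : Type*} {K : Type*} [Field K] [Fintype V] [LinearOrder V]

/-- The strand of degree `s` of the Koszul complex with coefficients in `R ⧸ J` is exact,
expressed with representatives in `R`. -/
def QuotientKoszulExact (J : Ideal (MvPolynomial V K)) (s : ℤ) : Prop :=
  ∀ c : Finset V → MvPolynomial V K, (∀ T, c T ∈ polyGrading V K s) →
    (∀ T, koszulD K _ c T ∈ J) →
    ∃ b : Finset V → MvPolynomial V K, (∀ T, b T ∈ polyGrading V K (s - 1)) ∧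
      ∀ T, (c - koszulD K _ b) T ∈ J

theorem koszulD_X_smul (x : V) (c : Finset V → MvPolynomial V K) :
    koszulD K _ (fun T => X x * c T) = fun T => X x * koszulD K _ c T :=
  map_smul (koszulD K _) (X x : MvPolynomial V K) c

/-- Exactness passes from `R ⧸ (J : x)` and `R ⧸ (J + x)` to `R ⧸ J`. -/
theorem QuotientKoszulExact.of_colon {J J₁ J₂ : Ideal (MvPolynomial V K)} {x : V} {s : ℤ}
    (hcolon : ∀ f, X x * f ∈ J ↔ f ∈ J₁) (hle : J ≤ J₂)
    (hmod : ∀ f ∈ J₂, f - X x * divX x f ∈ J)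
    (h₁ : QuotientKoszulExact J₁ (s - 1)) (h₂ : QuotientKoszulExact J₂ s) :
    QuotientKoszulExact J s := by
  intro c hc hd
  obtain ⟨b, hb, hbd⟩ := h₂ c hc fun T => hle (hd T)
  have hdb : ∀ T, koszulD K _ b T ∈ polyGrading V K s := fun T => by
    have := koszulD_poly_mem hb T
    rwa [sub_add_cancel] at this
  -- Modulo `J`, the chain `c - d b` is `x g`, so `g` is a cycle modulo the colon ideal, in degree
  -- `s - 1`.
  set g : Finset V → MvPolynomial V K := fun T => divX x ((c - koszulD K _ b) T) with hg
  have hgJ : ∀ T, (c - koszulD K _ b - (fun T => X x * g T) : Finset V → MvPolynomial V K) T ∈ J := fun T => hmod _ (hbd T)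
  have hgd : ∀ T, koszulD K _ g T ∈ J₁ := fun T => by
    have h := koszulD_mem J hgJ T
    rw [map_sub, map_sub, koszulD_koszulD, sub_zero, koszulD_X_smul] at h
    exact (hcolon _).1 ((Submodule.sub_mem_iff_right _ (hd T)).1 h)
  obtain ⟨a, ha, had⟩ := h₁ g (fun T => divX_mem_polyGrading x
    (Submodule.sub_mem _ (hc T) (hdb T))) hgd
  refine ⟨b + fun T => X x * a T, fun T => Submodule.add_mem _ (hb T) ?_, fun T => ?_⟩
  · have := X_mul_mem_polyGrading x (ha T)
    rwa [sub_add_cancel] at this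
  · have h := J.add_mem (hgJ T) ((hcolon _).2 (had T))
    rw [map_add, koszulD_X_smul]
    simp only [Pi.sub_apply, Pi.add_apply] at h ⊢
    convert h using 1
    ring

/-- Exactness passes from `R ⧸ J` to `R ⧸ (J + x)` if `x` is a nonzerodivisor on `R ⧸ J`. -/
theorem QuotientKoszulExact.of_nonzerodivisor {J J₂ : Ideal (MvPolynomial V K)} {x : V} {s : ℤ}
    (hcolon : ∀ f, X x * f ∈ J → f ∈ J) (hle : J ≤ J₂) (hX : X x ∈ J₂)
    (hmod : ∀ f ∈ J₂, f - X x * divX x f ∈ J) (h : QuotientKoszulExact J s) :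
    QuotientKoszulExact J₂ s := by
  intro c hc hd
  -- The connecting map: `d c` is `x g` modulo `J`. Bounding `g` by `b` turns `c - x b` into a cycle
  -- modulo `J`.
  set g : Finset V → MvPolynomial V K := fun T => divX x (koszulD K _ c T) with hg
  have hgs : ∀ T, g T ∈ polyGrading V K s := fun T => by
    have := divX_mem_polyGrading x (koszulD_poly_mem hc T)
    rwa [add_sub_cancel_right] at this
  have hgJ : ∀ T, (koszulD K _ c - (fun T => X x * g T) : Finset V → MvPolynomial V K) T ∈ J := fun T => hmod _ (hd T)
  have hgd : ∀ T, koszulD K _ g T ∈ J := fun T => by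
    have h := koszulD_mem J hgJ T
    rw [map_sub, koszulD_koszulD, zero_sub, koszulD_X_smul] at h
    exact hcolon _ (neg_mem_iff.1 h)
  obtain ⟨b, hb, hbd⟩ := h g hgs hgd
  obtain ⟨a, ha, had⟩ := h (c - fun T => X x * b T) (fun T => by
      refine Submodule.sub_mem _ (hc T) ?_
      have := X_mul_mem_polyGrading x (hb T)
      rwa [sub_add_cancel] at this) (fun T => by
      have h := J.add_mem (hgJ T) (J.mul_mem_left (X x) (hbd T))
      rw [map_sub, koszulD_X_smul]
      simp only [Pi.sub_apply] at h ⊢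
      convert h using 1
      ring)
  refine ⟨a, ha, fun T => ?_⟩
  have h := J₂.add_mem (hle (had T)) (J₂.mul_mem_right (b T) hX)
  simp only [Pi.sub_apply] at h ⊢
  convert h using 1
  ring

theorem quotientKoszulExact_bot {s : ℤ} (hs : s ≠ 0) :
    QuotientKoszulExact (⊥ : Ideal (MvPolynomial V K)) s := by
  intro c hc hd
  obtain ⟨b, hb, rfl⟩ := exists_koszulD_eq_poly hc (funext hd) (by
    by_contra h
    exact hs (by simpa using (mem_polyGrading_iff.1 (hc ∅) 0 h).symm))
  exact ⟨b, hb, fun T => by simp⟩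

/-- Without edges the ideal is generated by the variables outside `W`. Adding them one at a time,
each is a nonzerodivisor modulo the previous ones. -/
theorem quotientKoszulExact_restrictedIdeal_bot {s : ℤ} (hs : s ≠ 0) (W : Finset V) :
    QuotientKoszulExact (restrictedIdeal K (⊥ : SimpleGraph V) W) s := by
  suffices ∀ D : Finset V, QuotientKoszulExact (restrictedIdeal K (⊥ : SimpleGraph V) Dᶜ) s by
    simpa using this Wᶜ
  intro D
  induction D using Finset.induction_on with
  | empty =>
    suffices restrictedIdeal K (⊥ : SimpleGraph V) ∅ᶜ = ⊥ by
      rw [this]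
      exact quotientKoszulExact_bot hs
    rw [eq_bot_iff]
    intro f hf
    rw [Submodule.mem_bot]
    ext m
    by_contra hm
    rcases hf m hm with ⟨v, hv, -⟩ | ⟨u, -, v, -, huv, -⟩
    · simp at hv
    · exact huv
  | insert x D hx ih =>
    rw [Finset.compl_insert]
    refine ih.of_nonzerodivisor (fun f hf => ?_) (restrictedIdeal_le_erase _ x)
      (X_mem_restrictedIdeal_erase _ x) fun f hf => sub_X_mul_divX_mem_restrictedIdeal hf
    classical
    rw [X_mul_mem_restrictedIdeal_iff_filter (by simpa using hx)] at hf
    simpa using hf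

end QuotientExact

/-! ### Chordal graphs -/

section Chordal

variable {V : Type*} {G : SimpleGraph V}

theorem cycleGraph_adj_iff_of_lt {n : ℕ} {i j : Fin n} (h : i < j) :
    (SimpleGraph.cycleGraph n).Adj i j ↔ (j : ℕ) = i + 1 ∨ ((i : ℕ) = 0 ∧ (j : ℕ) + 1 = n) := by
  rw [SimpleGraph.cycleGraph_adj', Fin.coe_sub_iff_lt.2 h, Fin.coe_sub_iff_le.2 h.le]
  have := i.2
  have := j.2
  have : (i : ℕ) < j := h
  omega

/-- A cycle through `x` whose other vertices `v 0, …, v L` form an induced path, with only the ends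
adjacent to `x`, is an induced cycle. -/
theorem IsChordal.false_of_path (hG : IsChordal G) {x : V} {L : ℕ} (hL : 2 ≤ L) (v : ℕ → V)
    (hx : ∀ k ≤ L, v k ≠ x ∧ (G.Adj x (v k) ↔ k = 0 ∨ k = L))
    (hv : ∀ k l, k < l → l ≤ L → v k ≠ v l ∧ (G.Adj (v k) (v l) ↔ l = k + 1)) : False := by
  let f : Fin (L + 2) → V := fun i => if (i : ℕ) = 0 then x else v (i - 1)
  have hf : ∀ i j : Fin (L + 2), i < j →
      f i ≠ f j ∧ (G.Adj (f i) (f j) ↔ (SimpleGraph.cycleGraph (L + 2)).Adj i j) := by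
    intro i j hij
    rw [cycleGraph_adj_iff_of_lt hij]
    have hj := j.2
    have hij' : (i : ℕ) < j := hij
    simp only [f]
    rw [if_neg (by omega : ¬(j : ℕ) = 0)]
    split_ifs with hi
    · obtain ⟨h1, h2⟩ := hx (j - 1) (by omega)
      refine ⟨h1.symm, h2.trans ?_⟩
      omega
    · obtain ⟨h1, h2⟩ := hv (i - 1) (j - 1) (by omega) (by omega)
      refine ⟨h1, h2.trans ?_⟩
      omega
  refine (hG (L + 2) (by omega)).false ⟨⟨f, fun i j hij => ?_⟩, fun {i j} => ?_⟩
  · by_contra hne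
    rcases lt_or_gt_of_ne hne with h | h
    · exact (hf i j h).1 hij
    · exact (hf j i h).1 hij.symm
  · change G.Adj (f i) (f j) ↔ _
    rcases lt_trichotomy i j with h | rfl | h
    · exact (hf i j h).2
    · simp
    · rw [G.adj_comm, (hf j i h).2, SimpleGraph.adj_comm]

/-- In a chordal graph, two neighbours of `x` that are joined by a path avoiding the other
neighbours of `x` are adjacent. -/
theorem IsChordal.adj_of_reachable (hG : IsChordal G) {x s t : V} {A : Set V} {H : SimpleGraph V}
    (hH : ∀ a b, H.Adj a b ↔ G.Adj a b ∧ a ∈ A ∧ b ∈ A) (hxs : G.Adj x s) (hxt : G.Adj x t)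
    (hA : ∀ a ∈ A, a ≠ s → a ≠ t → a ≠ x ∧ ¬G.Adj x a) (hst : H.Reachable s t) :
    s = t ∨ G.Adj s t := by
  by_contra! hcon
  -- A shortest walk from `s` to `t` in `H` has no chords, so closing it up through `x` gives an
  -- induced cycle of length at least `4`.
  obtain ⟨p, hp⟩ := hst.exists_walk_length_eq_dist
  have hL : 2 ≤ p.length := by
    rw [hp]
    exact hst.one_lt_dist_of_ne_of_not_adj hcon.1 fun h => hcon.2 ((hH _ _).1 h).1
  have hdist : ∀ k ≤ p.length, H.dist s (p.getVert k) = k := by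
    intro k hk
    have h1 := SimpleGraph.dist_le (p.take k)
    have h2 := SimpleGraph.dist_le (p.drop k)
    rw [SimpleGraph.Walk.take_length] at h1
    rw [SimpleGraph.Walk.drop_length] at h2
    have h3 := (p.take k).reachable.dist_triangle_left t
    omega
  have hmem : ∀ k ≤ p.length, p.getVert k ∈ A := by
    intro k hk
    rcases Nat.lt_or_ge k p.length with h | h
    · exact ((hH _ _).1 (p.adj_getVert_succ h)).2.1
    · have h1 : k - 1 < p.length := by omega
      have := ((hH _ _).1 (p.adj_getVert_succ h1)).2.2
      rwa [Nat.sub_add_cancel (by omega)] at this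
  refine hG.false_of_path hL p.getVert (x := x) (fun k hk => ?_) (fun k l hkl hl => ?_)
  · by_cases h0 : k = 0
    · subst h0
      simp [hxs, hxs.ne']
    · by_cases h1 : k = p.length
      · subst h1
        simp [hxt, hxt.ne']
      · have := hA _ (hmem k hk) (fun h => h0 (by rw [← hdist k hk, h, SimpleGraph.dist_self]))
          (fun h => h1 (by rw [← hdist k hk, h, hp]))
        simp [this, h0, h1]
  · constructor
    · intro h
      have := hdist k (by omega)
      rw [h, hdist l hl] at this
      omega
    · constructor
      · intro h
        have h1 : H.Adj (p.getVert k) (p.getVert l) :=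
          (hH _ _).2 ⟨h, hmem k (by omega), hmem l hl⟩
        have h2 := h1.diff_dist_adj (u := s)
        rw [hdist l hl, hdist k (by omega)] at h2
        omega
      · rintro rfl
        exact ((hH _ _).1 (p.adj_getVert_succ (by omega))).1

/-- One step inside `W`, to a vertex outside the closed neighbourhood of `x`. -/
def AvoidingStep (G : SimpleGraph V) (W : Set V) (x a b : V) : Prop :=
  G.Adj a b ∧ b ∈ W ∧ b ≠ x ∧ ¬G.Adj x b

/-- The set reachable from `c` avoids `N[x]` and touches both `s` and `t`, so it joins these two
neighbours of `x` without meeting further ones. -/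
theorem IsChordal.adj_of_avoiding (hG : IsChordal G) {W : Set V} {x c s t c₁ c₂ : V}
    (hc : c ≠ x ∧ ¬G.Adj x c) (hxs : G.Adj x s) (hxt : G.Adj x t) (hs : G.Adj s c₁)
    (ht : G.Adj t c₂) (h₁ : Relation.ReflTransGen (AvoidingStep G W x) c c₁)
    (h₂ : Relation.ReflTransGen (AvoidingStep G W x) c c₂) : s = t ∨ G.Adj s t := by
  let A : Set V := {a | Relation.ReflTransGen (AvoidingStep G W x) c a ∨ a = s ∨ a = t}
  let H : SimpleGraph V :=
    { Adj := fun a b => G.Adj a b ∧ a ∈ A ∧ b ∈ A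
      symm := ⟨fun a b h => ⟨h.1.symm, h.2.2, h.2.1⟩⟩
      loopless := ⟨fun a h => h.1.ne rfl⟩ }
  have hreach : ∀ a, Relation.ReflTransGen (AvoidingStep G W x) c a → H.Reachable c a := by
    intro a ha
    induction ha with
    | refl => exact SimpleGraph.Reachable.refl c
    | tail hab hb ih =>
      refine ih.trans (SimpleGraph.Adj.reachable ?_)
      exact ⟨hb.1, Or.inl hab, Or.inl (hab.tail hb)⟩
  refine hG.adj_of_reachable (A := A) (H := H) (fun _ _ => Iff.rfl) hxs hxt ?_ ?_
  · rintro a (ha | ha | ha) has hat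
    · induction ha with
      | refl => exact hc
      | tail _ hb => exact hb.2.2
    · exact absurd ha has
    · exact absurd ha hat
  · have h3 : H.Adj s c₁ := ⟨hs, Or.inr (Or.inl rfl), Or.inl h₁⟩
    have h4 : H.Adj t c₂ := ⟨ht, Or.inr (Or.inr rfl), Or.inl h₂⟩
    exact h3.reachable.trans ((hreach _ h₁).symm.trans ((hreach _ h₂).trans h4.symm.reachable))

/-- In an induced subgraph with an edge of a finite chordal graph, there is an edge `v x` such that
the closed neighbourhood of `v` is contained in that of `x`. -/
theorem IsChordal.exists_dominated [Finite V] (hG : IsChordal G) {W : Set V}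
    (hW : ∃ u ∈ W, ∃ v ∈ W, G.Adj u v) :
    ∃ v ∈ W, ∃ x ∈ W, G.Adj v x ∧ ∀ w ∈ W, G.Adj v w → w = x ∨ G.Adj x w := by
  by_contra! hcon
  -- Descent on the component of `c` in `W` outside `N[x]`. As `s` does not dominate `c`, there is a
  -- neighbour `c'` of `c` outside `N[s]`, and its component outside `N[s]` is strictly smaller.
  have key : ∀ (n : ℕ) (x s c : V), s ∈ W → c ∈ W → G.Adj x s → G.Adj s c →
      c ≠ x ∧ ¬G.Adj x c →
      {a | Relation.ReflTransGen (AvoidingStep G W x) c a}.ncard = n → False := by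
    intro n
    induction n using Nat.strong_induction_on with
    | _ n ih =>
      intro x s c hs hcW hxs hsc hc hn
      obtain ⟨c', hc'W, hcc', hc's, hsc'⟩ := hcon c hcW s hs hsc.symm
      refine ih _ ?_ s c c' hcW hc'W hsc hcc' ⟨hc's, hsc'⟩ rfl
      rw [← hn]
      have hstep : ∀ a b, Relation.ReflTransGen (AvoidingStep G W x) c a → G.Adj a b → b ∈ W →
          b ≠ s → ¬G.Adj s b → AvoidingStep G W x a b := by
        intro a b ha hab hb hbs hsb
        refine ⟨hab, hb, ?_, fun hxb => ?_⟩
        · rintro rfl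
          exact hsb hxs.symm
        -- If `b` were adjacent to `x`, then `s` and `b` would be neighbours of `x` joined through
        -- the component of `c`, and chordality would put `b` into `N[s]`.
        · rcases hG.adj_of_avoiding hc hxs hxb hsc hab.symm .refl ha with h | h
          · exact hbs h.symm
          · exact hsb h
      refine Set.ncard_lt_ncard ⟨fun a ha => ?_, fun hsub => ?_⟩ (Set.toFinite _)
      · change Relation.ReflTransGen _ _ _ at ha
        induction ha with
        | refl => exact .single (hstep c c' .refl hcc' hc'W hc's hsc')
        | tail _ hb ih' => exact .tail ih' (hstep _ _ ih' hb.1 hb.2.1 hb.2.2.1 hb.2.2.2)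
      -- The inclusion is strict: `c` is adjacent to `s`, so it is never reached from `c'`.
      · have : Relation.ReflTransGen (AvoidingStep G W s) c' c := hsub Relation.ReflTransGen.refl
        rcases Relation.ReflTransGen.cases_tail this with h | ⟨b, -, hb⟩
        · subst h
          exact hsc' hsc
        · exact hb.2.2.2 hsc
  obtain ⟨u, hu, v, hv, huv⟩ := hW
  obtain ⟨w, hw, hvw, hwu, huw⟩ := hcon v hv u hu huv.symm
  exact key _ u v w hv hw huv hvw ⟨hwu, huw⟩ rfl

end Chordal

/-! ### The upper bound -/

section UpperBound

variable {V : Type*} {G : SimpleGraph V}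

theorem IsInducedMatching.empty (G : SimpleGraph V) : IsInducedMatching G ∅ where
  subset_edgeSet := by simp
  disjoint := by simp
  induced e _ h := by
    induction e with
    | _ a b =>
      obtain ⟨f, hf, _⟩ := h a (Sym2.mem_mk_left a b)
      simp at hf

/-- An induced matching avoiding the neighbours of `x` extends by an edge `v x` such that all
neighbours of `v` are equal or adjacent to `x`. -/
theorem IsInducedMatching.insert_edge [DecidableEq V] {C : Finset (Sym2 V)} {W : Finset V} {v x : V}
    (hC : IsInducedMatching G C) (hCW : ∀ e ∈ C, ∀ u ∈ e, u ∈ W ∧ ¬G.Adj x u)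
    (hvx : G.Adj v x) (hdom : ∀ w ∈ W, G.Adj v w → w = x ∨ G.Adj x w) :
    IsInducedMatching G (insert s(v, x) C) ∧ s(v, x) ∉ C := by
  have hx : ∀ e ∈ C, x ∉ e := by
    intro e he hxe
    obtain ⟨y, rfl⟩ := Sym2.mem_iff_exists.1 hxe
    exact (hCW _ he y (Sym2.mem_mk_right x y)).2 (hC.subset_edgeSet _ he)
  have hv : ∀ e ∈ C, v ∉ e := fun e he hve => (hCW e he v hve).2 hvx.symm
  have hdis : ∀ e ∈ C, ∀ w, w ∈ s(v, x) → w ∉ e := by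
    intro e he w hw
    rcases Sym2.mem_iff.1 hw with rfl | rfl
    · exact hv e he
    · exact hx e he
  refine ⟨⟨?_, ?_, ?_⟩, fun h => hx _ h (Sym2.mem_mk_right v x)⟩
  · intro e he
    rcases Finset.mem_insert.1 he with rfl | he
    · exact hvx
    · exact hC.subset_edgeSet e he
  · intro e he f hf hef w hwe hwf
    rcases Finset.mem_insert.1 he with rfl | he
    · rcases Finset.mem_insert.1 hf with rfl | hf
      · exact hef rfl
      · exact hdis f hf w hwe hwf
    · rcases Finset.mem_insert.1 hf with rfl | hf
      · exact hdis e he w hwf hwe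
      · exact hC.disjoint e he f hf hef w hwe hwf
  · intro e he hcov
    induction e with
    | _ a b =>
      have hab : G.Adj a b := he
      have hcase : ∀ w ∈ s(a, b), (∃ f ∈ C, w ∈ f) ∨ w = v ∨ w = x := by
        intro w hw
        obtain ⟨f, hf, hwf⟩ := hcov w hw
        rcases Finset.mem_insert.1 hf with rfl | hf
        · exact Or.inr (Sym2.mem_iff.1 hwf)
        · exact Or.inl ⟨f, hf, hwf⟩
      have hxC : ∀ w, (∃ f ∈ C, w ∈ f) → ¬G.Adj x w :=
        fun w ⟨f, hf, hwf⟩ => (hCW f hf w hwf).2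
      have hvC : ∀ w, (∃ f ∈ C, w ∈ f) → ¬G.Adj v w := by
        rintro w ⟨f, hf, hwf⟩ hvw
        rcases hdom w (hCW f hf w hwf).1 hvw with rfl | h
        · exact hx f hf hwf
        · exact (hCW f hf w hwf).2 h
      rw [Finset.mem_insert]
      rcases hcase a (Sym2.mem_mk_left a b) with ha | rfl | rfl <;>
        rcases hcase b (Sym2.mem_mk_right a b) with hb | rfl | rfl
      · right
        refine hC.induced _ he fun w hw => ?_
        rcases Sym2.mem_iff.1 hw with rfl | rfl
        · exact ha
        · exact hb
      · exact absurd hab.symm (hvC a ha)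
      · exact absurd hab.symm (hxC a ha)
      · exact absurd hab (hvC b hb)
      · exact absurd rfl hab.ne
      · exact Or.inl rfl
      · exact absurd hab (hxC b hb)
      · exact Or.inl Sym2.eq_swap
      · exact absurd rfl hab.ne

variable {K : Type*} [Field K] [Fintype V] [LinearOrder V]

/-- Above the induced matching number of the induced subgraph on `W`, the strands of the Koszul
complex of the quotient by its edge ideal are exact. -/
theorem IsChordal.quotientKoszulExact (hG : IsChordal G) (W : Finset V) (s : ℤ)
    (hs : ∀ C, IsInducedMatching G C → (∀ e ∈ C, ∀ v ∈ e, v ∈ W) → (C.card : ℤ) < s) :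
    QuotientKoszulExact (restrictedIdeal K G W) s := by
  classical
  induction W using Finset.strongInduction generalizing s with
  | H W ih =>
    by_cases hW : ∃ u ∈ W, ∃ v ∈ W, G.Adj u v
    · obtain ⟨v, hv, x, hx, hvx, hdom⟩ := hG.exists_dominated (W := (W : Set V)) hW
      refine QuotientKoszulExact.of_colon (fun f => X_mul_mem_restrictedIdeal_iff_filter hx)
        (restrictedIdeal_le_erase W x) (fun f hf => sub_X_mul_divX_mem_restrictedIdeal hf)
        (ih _ ?_ _ fun C hC hCW => ?_) (ih _ (Finset.erase_ssubset hx) _ fun C hC hCW => ?_)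
      · exact Finset.filter_ssubset.2 ⟨v, hv, not_not.2 hvx.symm⟩
      · obtain ⟨h1, h2⟩ := hC.insert_edge (fun e he u hu => Finset.mem_filter.1 (hCW e he u hu))
          hvx hdom
        have := hs _ h1 (fun e he u hu => by
          rcases Finset.mem_insert.1 he with rfl | he
          · rcases Sym2.mem_iff.1 hu with rfl | rfl
            · exact hv
            · exact hx
          · exact (Finset.mem_filter.1 (hCW e he u hu)).1)
        rw [Finset.card_insert_of_notMem h2] at this
        push_cast at this
        omega
      · exact hs C hC fun e he u hu => Finset.mem_of_mem_erase (hCW e he u hu)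
    · push Not at hW
      rw [restrictedIdeal_congr (G' := ⊥) fun u hu v hv => by simp [hW u hu v hv]]
      refine quotientKoszulExact_restrictedIdeal_bot ?_ W
      have := hs ∅ (IsInducedMatching.empty G) (by simp)
      simp at this
      omega

end UpperBound

/-! ### The lower bound -/

section LowerBound

variable {V : Type*}

/-- The exponent of the squarefree monomial with support `S`. -/
noncomputable def squarefreeExponent (S : Finset V) : V →₀ ℕ := ∑ v ∈ S, Finsupp.single v 1

theorem degree_squarefreeExponent (S : Finset V) : (squarefreeExponent S).degree = S.card := by
  simp [squarefreeExponent, map_sum, Finsupp.degree_single]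

variable [DecidableEq V]

theorem squarefreeExponent_apply (S : Finset V) (v : V) :
    squarefreeExponent S v = if v ∈ S then 1 else 0 := by
  simp [squarefreeExponent, Finsupp.single_apply]

theorem squarefreeExponent_apply_ne_zero {S : Finset V} {v : V} :
    squarefreeExponent S v ≠ 0 ↔ v ∈ S := by
  simp [squarefreeExponent_apply]

theorem squarefreeExponent_sub_single {S : Finset V} {v : V} :
    squarefreeExponent S - Finsupp.single v 1 = squarefreeExponent (S.erase v) := by
  ext w
  rw [Finsupp.tsub_apply, squarefreeExponent_apply, squarefreeExponent_apply,
    Finsupp.single_apply]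
  simp only [Finset.mem_erase]
  by_cases h : v = w
  · subst h
    simp
    split_ifs <;> simp
  · simp [h, Ne.symm h]

/-- `p` is a fixed-point free involution of `W`, pairing the vertices of an induced matching. -/
structure IsPairing (W : Finset V) (p : V → V) : Prop where
  mem : ∀ v ∈ W, p v ∈ W
  invol : ∀ v ∈ W, p (p v) = v
  ne : ∀ v ∈ W, p v ≠ v

/-- The subsets of `W` containing exactly one vertex of each pair. -/
def transversals (W : Finset V) (p : V → V) : Finset (Finset V) :=
  W.powerset.filter fun T => ∀ v ∈ W, p v ∈ T ↔ v ∉ T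

theorem mem_transversals {W : Finset V} {p : V → V} {T : Finset V} :
    T ∈ transversals W p ↔ T ⊆ W ∧ ∀ v ∈ W, p v ∈ T ↔ v ∉ T := by
  simp [transversals]

theorem IsPairing.swap_mem_transversals {W : Finset V} {p : V → V} (hp : IsPairing W p)
    {T : Finset V} (hT : T ∈ transversals W p) {v : V} (hv : v ∈ W) (hvT : v ∉ T) :
    (insert v T).erase (p v) ∈ transversals W p := by
  rw [mem_transversals] at hT ⊢
  refine ⟨(Finset.erase_subset _ _).trans (Finset.insert_subset hv hT.1), fun w hw => ?_⟩
  have h1 := hp.ne v hv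
  have h2 := hp.invol v hv
  simp only [Finset.mem_erase, Finset.mem_insert]
  by_cases hwv : w = v
  · subst hwv
    simp [h1.symm]
  · by_cases hwp : w = p v
    · subst hwp
      simp [h2, h1.symm]
    · have h3 : p w ≠ v := fun h => hwp (by rw [← h, hp.invol w hw])
      have h4 : p w ≠ p v := fun h => hwv (by rw [← hp.invol w hw, h, h2])
      simp [hwv, hwp, h3, h4, hT.2 w hw]

theorem IsPairing.insert_swap {W : Finset V} {p : V → V} {T : Finset V}
    (hT : T ∈ transversals W p) {v : V} (hv : v ∈ W) (hvT : v ∉ T) :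
    insert (p v) ((insert v T).erase (p v)) = insert v T := by
  rw [mem_transversals] at hT
  exact Finset.insert_erase (Finset.mem_insert_of_mem ((hT.2 v hv).2 hvT))

/-- Sum of the coefficients of a Koszul chain at the complementary squarefree monomials, over all
transversals. -/
noncomputable def transversalFunctional {K : Type*} [Field K] (W : Finset V) (p : V → V)
    (c : Finset V → MvPolynomial V K) : K :=
  ∑ T ∈ transversals W p, coeff (squarefreeExponent (W \ T)) (c T)

end LowerBound

section LowerBoundOrder

variable {V : Type*} [LinearOrder V]

/-- No vertex of `W` lies between two partners, so their signs differ only through their mutual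
order. This is why `transversalFunctional` needs no signs. -/
theorem IsPairing.koszulSign_swap {W : Finset V} {p : V → V} (hp : IsPairing W p)
    (hord : ∀ v ∈ W, ∀ w ∈ W, w ≠ v → w ≠ p v → (w < v ↔ w < p v)) {T : Finset V}
    (hT : T ∈ transversals W p) {v : V} (hv : v ∈ W) (hvT : v ∉ T) :
    koszulSign v T = -koszulSign (p v) ((insert v T).erase (p v)) := by
  rw [mem_transversals] at hT
  have hpT := (hT.2 v hv).2 hvT
  have h1 := hp.ne v hv
  rw [Finset.erase_insert_of_ne h1.symm]
  set S := T.erase (p v) with hS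
  have hvS : v ∉ S := fun h => hvT (Finset.mem_of_mem_erase h)
  have hpS : p v ∉ S := Finset.notMem_erase _ _
  have hsign : koszulSign v S = koszulSign (p v) S := by
    rw [koszulSign, koszulSign]
    congr 2
    refine Finset.filter_congr fun w hw => hord v hv w (hT.1 (Finset.mem_of_mem_erase hw)) ?_ ?_
    · rintro rfl
      exact hvS hw
    · exact Finset.ne_of_mem_erase hw
  have hTS : T = insert (p v) S := (Finset.insert_erase hpT).symm
  rw [hTS]
  rcases lt_or_gt_of_ne h1 with h | h
  · rw [koszulSign_insert_of_lt hpS h, koszulSign_insert_of_gt h, hsign]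
  · rw [koszulSign_insert_of_gt h, koszulSign_insert_of_lt hvS h, hsign, neg_neg]

variable [Fintype V] {K : Type*} [Field K]

theorem coeff_koszulD (c : Finset V → MvPolynomial V K) (W T : Finset V) :
    coeff (squarefreeExponent (W \ T)) (koszulD K _ c T) =
      ∑ v ∈ W \ T,
        koszulSign v T • coeff (squarefreeExponent (W \ insert v T)) (c (insert v T)) := by
  rw [koszulD_apply, coeff_sum]
  symm
  have hsub : W \ T ⊆ Tᶜ := fun v hv => by
    rw [Finset.mem_compl]
    exact (Finset.mem_sdiff.1 hv).2
  refine (Finset.sum_congr rfl fun v hv => ?_).trans (Finset.sum_subset hsub fun v _ hv => ?_)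
  · rw [coeff_smul, smul_eq_mul, coeff_X_mul_of_ne_zero (squarefreeExponent_apply_ne_zero.2 hv),
      squarefreeExponent_sub_single, Finset.sdiff_insert]
  · rw [coeff_smul, smul_eq_mul, coeff_X_mul_of_eq_zero, smul_zero]
    by_contra h
    exact hv (squarefreeExponent_apply_ne_zero.1 h)

/-- For `v` outside `T`, the coordinate of `c` at `T ∪ {v}` contributes at the transversal `T` and
at the one obtained by removing `p v` instead of `v`, with opposite signs. -/
theorem IsPairing.transversalFunctional_koszulD {W : Finset V} {p : V → V} (hp : IsPairing W p)
    (hord : ∀ v ∈ W, ∀ w ∈ W, w ≠ v → w ≠ p v → (w < v ↔ w < p v))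
    (c : Finset V → MvPolynomial V K) :
    transversalFunctional W p (koszulD K _ c) = 0 := by
  simp only [transversalFunctional, coeff_koszulD, Finset.sum_sigma']
  refine Finset.sum_involution (fun q _ => ⟨(insert q.2 q.1).erase (p q.2), p q.2⟩) ?_ ?_ ?_ ?_
  · rintro ⟨T, v⟩ h
    obtain ⟨hT, hvT⟩ := Finset.mem_sigma.1 h
    obtain ⟨hv, hvT⟩ := Finset.mem_sdiff.1 hvT
    dsimp only
    rw [IsPairing.insert_swap hT hv hvT, hp.koszulSign_swap hord hT hv hvT, neg_smul,
      neg_add_cancel]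
  · rintro ⟨T, v⟩ h _ heq
    obtain ⟨hT, hvT⟩ := Finset.mem_sigma.1 h
    exact hp.ne v (Finset.mem_sdiff.1 hvT).1 (congrArg Sigma.snd heq)
  · rintro ⟨T, v⟩ h
    obtain ⟨hT, hvT⟩ := Finset.mem_sigma.1 h
    obtain ⟨hv, hvT⟩ := Finset.mem_sdiff.1 hvT
    exact Finset.mem_sigma.2 ⟨hp.swap_mem_transversals hT hv hvT,
      Finset.mem_sdiff.2 ⟨hp.mem v hv, Finset.notMem_erase _ _⟩⟩
  · rintro ⟨T, v⟩ h
    obtain ⟨hT, hvT⟩ := Finset.mem_sigma.1 h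
    obtain ⟨hv, hvT⟩ := Finset.mem_sdiff.1 hvT
    dsimp only
    rw [IsPairing.insert_swap hT hv hvT, hp.invol v hv, Finset.erase_insert hvT]

/-- The Koszul homology of the quotient by the edge ideal does not vanish in the strand given by
the size of an induced matching. -/
theorem IsPairing.not_quotientKoszulExact {G : SimpleGraph V} {W : Finset V} {p : V → V}
    (hp : IsPairing W p) (hG : ∀ u ∈ W, ∀ v ∈ W, G.Adj u v ↔ u = p v)
    (hord : ∀ v ∈ W, ∀ w ∈ W, w ≠ v → w ≠ p v → (w < v ↔ w < p v)) :
    ¬QuotientKoszulExact (restrictedIdeal K G Finset.univ) (W.filter fun v => v < p v).card := by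
  intro hex
  set A := W.filter fun v => v < p v with hA
  set B := W.filter fun v => p v < v with hB
  have hBT : B ∈ transversals W p := by
    refine mem_transversals.2 ⟨Finset.filter_subset _ _, fun v hv => ?_⟩
    rw [hB, Finset.mem_filter, Finset.mem_filter, hp.invol v hv]
    have := hp.ne v hv
    have := hp.mem v hv
    simp only [*, true_and, not_lt]
    exact ⟨le_of_lt, fun h => lt_of_le_of_ne h (hp.ne v hv).symm⟩
  have hWB : W \ B = A := by
    ext v
    simp only [hA, hB, Finset.mem_sdiff, Finset.mem_filter, not_and, not_lt]
    exact ⟨fun h => ⟨h.1, lt_of_le_of_ne (h.2 h.1) (hp.ne v h.1).symm⟩,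
      fun h => ⟨h.1, fun _ => h.2.le⟩⟩
  let z : Finset V → MvPolynomial V K :=
    fun T => if T = B then monomial (squarefreeExponent A) 1 else 0
  obtain ⟨b, -, hb⟩ := hex z (fun T => by
    simp only [z]
    split_ifs
    · have := monomial_mem_polyGrading (squarefreeExponent A) (1 : K)
      rwa [degree_squarefreeExponent] at this
    · exact Submodule.zero_mem _) (fun T => by
    rw [koszulD_apply]
    -- Removing `v` from `B` multiplies `x_A` by `x_v`; since `p v` lies in `A`, the product is
    -- divisible by an edge.
    refine Submodule.sum_mem _ fun v hv => zsmul_mem ?_ _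
    simp only [z]
    split_ifs with h
    · have hvB : v ∈ B := h ▸ Finset.mem_insert_self v T
      rw [smul_eq_mul, X_mul_mem_restrictedIdeal_iff]
      intro m hm
      rw [coeff_monomial] at hm
      split_ifs at hm with h'
      · subst h'
        have hvW := (Finset.mem_filter.1 hvB).1
        have hpA : p v ∈ A := Finset.mem_filter.2 ⟨hp.mem v hvW, by
          rw [hp.invol v hvW]
          exact (Finset.mem_filter.1 hvB).2⟩
        refine Or.inr ⟨p v, Finset.mem_univ _, v, Finset.mem_univ _,
          (hG _ (hp.mem v hvW) v hvW).2 rfl, ?_, by simp⟩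
        have := squarefreeExponent_apply_ne_zero.2 hpA
        rw [Finsupp.add_apply]
        omega
      · exact absurd rfl hm
    · rw [smul_zero]
      exact Submodule.zero_mem _)
  -- For a transversal `T`, the set `W \ T` is independent, so `x_{W \ T}` occurs in no element of
  -- the ideal.
  have h1 : transversalFunctional W p (z - koszulD K _ b) = 0 := by
    refine Finset.sum_eq_zero fun T hT => ?_
    by_contra h
    rcases hb T _ h with ⟨v, hv, -⟩ | ⟨u, -, v, -, huv, hu, hv⟩
    · exact hv (Finset.mem_univ v)
    · rw [squarefreeExponent_apply_ne_zero, Finset.mem_sdiff] at hu hv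
      rw [hG u hu.1 v hv.1] at huv
      rw [mem_transversals] at hT
      exact hu.2 (huv ▸ (hT.2 v hv.1).2 hv.2)
  have h2 : transversalFunctional W p z = 1 := by
    rw [transversalFunctional, Finset.sum_eq_single_of_mem B hBT]
    · simp [z, hWB]
    · intro T _ hT
      simp [z, hT]
  have h3 : transversalFunctional W p (z - koszulD K _ b) =
      transversalFunctional W p z - transversalFunctional W p (koszulD K _ b) := by
    simp [transversalFunctional, Finset.sum_sub_distrib]
  rw [h1, h2, hp.transversalFunctional_koszulD hord, sub_zero] at h3
  exact zero_ne_one h3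

end LowerBoundOrder

/-! ### From an induced matching to a pairing with a compatible order -/

section LowerBoundMatching

variable {V : Type*} [Fintype V] (K : Type*) [Field K]

/-- The order only fixes signs in the Koszul complex, while Betti numbers do not depend on it, so it
may be adapted to the matching. -/
theorem IsInducedMatching.exists_not_quotientKoszulExact {G : SimpleGraph V} {C : Finset (Sym2 V)}
    (hC : IsInducedMatching G C) :
    ∃ _ : LinearOrder V,
      ¬QuotientKoszulExact (restrictedIdeal K G Finset.univ) (C.card : ℤ) := by
  classical
  set W : Finset V := Finset.univ.filter fun v => ∃ e ∈ C, v ∈ e with hW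
  have hmemW : ∀ v, v ∈ W ↔ ∃ e ∈ C, v ∈ e := by simp [hW]
  have hex : ∀ v, ∃ w, v ∈ W → s(v, w) ∈ C := by
    intro v
    by_cases hv : v ∈ W
    · obtain ⟨e, he, hve⟩ := (hmemW v).1 hv
      obtain ⟨w, rfl⟩ := Sym2.mem_iff_exists.1 hve
      exact ⟨w, fun _ => he⟩
    · exact ⟨v, fun h => absurd h hv⟩
  choose p hpC using hex
  have huniq : ∀ v w, s(v, w) ∈ C → w = p v := by
    intro v w h
    have hv : v ∈ W := (hmemW v).2 ⟨_, h, Sym2.mem_mk_left v w⟩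
    by_contra hne
    exact hC.disjoint _ h _ (hpC v hv) (fun h' => hne (Sym2.congr_right.1 h')) v
      (Sym2.mem_mk_left v w) (Sym2.mem_mk_left v _)
  have hp : IsPairing W p :=
    { mem := fun v hv => (hmemW _).2 ⟨_, hpC v hv, Sym2.mem_mk_right _ _⟩
      invol := fun v hv => by
        refine (huniq (p v) v ?_).symm
        rw [Sym2.eq_swap]
        exact hpC v hv
      ne := fun v hv h => by
        have h1 : G.Adj v (p v) := hC.subset_edgeSet _ (hpC v hv)
        exact h1.ne h.symm }
  have hG : ∀ u ∈ W, ∀ v ∈ W, G.Adj u v ↔ u = p v := by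
    intro u hu v hv
    constructor
    · intro huv
      refine huniq v u (hC.induced _ huv.symm fun w hw => ?_)
      rcases Sym2.mem_iff.1 hw with rfl | rfl
      · exact (hmemW _).1 hv
      · exact (hmemW _).1 hu
    · rintro rfl
      have h1 : G.Adj v (p v) := hC.subset_edgeSet _ (hpC v hv)
      exact h1.symm
  -- Vertices are compared by their pair, ties being broken arbitrarily; thus partners are
  -- consecutive in `W`.
  let r : V → Fin (Fintype.card (Sym2 V)) ×ₗ Fin (Fintype.card V) :=
    fun v => toLex (Fintype.equivFin _ s(v, p v), Fintype.equivFin V v)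
  have hr : Function.Injective r := fun v w h =>
    (Fintype.equivFin V).injective (congrArg (fun q => (ofLex q).2) h)
  let o : LinearOrder V := LinearOrder.lift' r hr
  have hlt : ∀ v w, v < w ↔ r v < r w := fun _ _ => Iff.rfl
  have hord : ∀ v ∈ W, ∀ w ∈ W, w ≠ v → w ≠ p v → (w < v ↔ w < p v) := by
    intro v hv w hw hwv hwp
    have h1 : s(p v, p (p v)) = s(v, p v) := by rw [hp.invol v hv, Sym2.eq_swap]
    have h2 : s(w, p w) ≠ s(v, p v) := by
      intro h
      have : w ∈ s(v, p v) := h ▸ Sym2.mem_mk_left w _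
      rcases Sym2.mem_iff.1 this with h | h
      · exact hwv h
      · exact hwp h
    have h3 : Fintype.equivFin _ s(w, p w) ≠ Fintype.equivFin _ s(v, p v) :=
      fun h => h2 ((Fintype.equivFin _).injective h)
    rw [hlt, hlt]
    simp only [r, Prod.Lex.toLex_lt_toLex, h1, h3, false_and, or_false]
  refine ⟨o, ?_⟩
  have hcard : (W.filter fun v => v < p v).card = C.card := by
    refine Finset.card_bij (fun v _ => s(v, p v)) ?_ ?_ ?_
    · intro v hv
      exact hpC v (Finset.mem_filter.1 hv).1
    · intro v hv w hw h
      rw [Finset.mem_filter] at hv hw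
      rcases Sym2.eq_iff.1 h with h | h
      · exact h.1
      · have h1 := hv.2
        rw [h.2, h.1] at h1
        exact absurd h1 hw.2.not_gt
    · intro e he
      induction e with
      | _ a b =>
        have ha : a ∈ W := (hmemW a).2 ⟨_, he, Sym2.mem_mk_left a b⟩
        obtain rfl := huniq a b he
        rcases lt_or_gt_of_ne (hp.ne a ha) with h | h
        · refine ⟨p a, Finset.mem_filter.2 ⟨hp.mem a ha, by rwa [hp.invol a ha]⟩, ?_⟩
          rw [hp.invol a ha, Sym2.eq_swap]
        · exact ⟨a, Finset.mem_filter.2 ⟨ha, h⟩, rfl⟩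
  rw [← hcard]
  exact hp.not_quotientKoszulExact hG hord

end LowerBoundMatching

/-! ### Existence of minimal graded free resolutions -/

section Existence

variable {V K : Type*} [Field K]

/-- A submodule of a graded free module is homogeneous if it contains the components of its
elements. -/
def IsHomogeneousSubmodule {n : ℕ} (δ : Fin n → ℤ)
    (N : Submodule (MvPolynomial V K) (Fin n → MvPolynomial V K)) : Prop :=
  ∀ x ∈ N, ∀ j, shiftedComp δ j x ∈ N

theorem IsHomogeneousSubmodule.ker {n n' : ℕ} {δ : Fin n → ℤ} {δ' : Fin n' → ℤ}
    (φ : (Fin n → MvPolynomial V K) →ₗ[MvPolynomial V K] (Fin n' → MvPolynomial V K))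
    (hφ : ∀ j, ∀ x ∈ shiftedGrading V K δ j, φ x ∈ shiftedGrading V K δ' j) :
    IsHomogeneousSubmodule δ (LinearMap.ker φ) := by
  intro x hx j
  rw [LinearMap.mem_ker] at hx ⊢
  rw [shiftedComp_comm φ hφ, hx, map_zero]

theorem exists_sum_shiftedComp {n : ℕ} (δ : Fin n → ℤ) (x : Fin n → MvPolynomial V K) :
    ∃ J : Finset ℤ, ∑ j ∈ J, shiftedComp δ j x = x := by
  classical
  refine ⟨Finset.univ.biUnion fun b => (x b).support.image fun m => (m.degree : ℤ) + δ b, ?_⟩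
  funext b
  ext m
  rw [Finset.sum_apply, coeff_sum]
  simp only [shiftedComp_apply, coeff_polyComp]
  by_cases hm : coeff m (x b) = 0
  · simp [hm]
  · rw [Finset.sum_eq_single_of_mem ((m.degree : ℤ) + δ b)]
    · simp
    · exact Finset.mem_biUnion.2 ⟨b, Finset.mem_univ b,
        Finset.mem_image.2 ⟨m, mem_support_iff.2 hm, rfl⟩⟩
    · intro j _ hj
      rw [if_neg]
      omega

/-- A homogeneous submodule is generated by finitely many homogeneous elements. -/
theorem IsHomogeneousSubmodule.exists_generators [Finite V] {n : ℕ} {δ : Fin n → ℤ}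
    {N : Submodule (MvPolynomial V K) (Fin n → MvPolynomial V K)}
    (hN : IsHomogeneousSubmodule δ N) :
    ∃ S : Finset (Fin n → MvPolynomial V K),
      (∀ x ∈ S, ∃ j, x ∈ shiftedGrading V K δ j) ∧
        Submodule.span (MvPolynomial V K) (S : Set (Fin n → MvPolynomial V K)) = N := by
  set A : Set (Fin n → MvPolynomial V K) := {x | x ∈ N ∧ ∃ j, x ∈ shiftedGrading V K δ j}
    with hA
  have hspan : Submodule.span (MvPolynomial V K) A = N := by
    refine le_antisymm (Submodule.span_le.2 fun x hx => hx.1) fun x hx => ?_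
    obtain ⟨J, hJ⟩ := exists_sum_shiftedComp δ x
    rw [← hJ]
    exact Submodule.sum_mem _ fun j _ =>
      Submodule.subset_span ⟨hN x hx j, j, shiftedComp_mem j x⟩
  have hfg : (Submodule.span (MvPolynomial V K) A).FG := IsNoetherian.noetherian _
  obtain ⟨S, hSA, hS⟩ := (Submodule.fg_span_iff_fg_span_finset_subset A).1 hfg
  exact ⟨S, fun x hx => (hSA hx).2, hS.symm.trans hspan⟩

theorem linearCombination_mem_shiftedGrading {n n' : ℕ} {δ : Fin n → ℤ} {δ' : Fin n' → ℤ}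
    {g : Fin n' → Fin n → MvPolynomial V K} (hg : ∀ b, g b ∈ shiftedGrading V K δ (δ' b)) (j : ℤ)
    (x : Fin n' → MvPolynomial V K) (hx : x ∈ shiftedGrading V K δ' j) :
    Fintype.linearCombination (MvPolynomial V K) g x ∈ shiftedGrading V K δ j := by
  rw [Fintype.linearCombination_apply]
  refine Submodule.sum_mem _ fun b _ => mem_shiftedGrading_iff.2 fun a => ?_
  have h1 := mem_shiftedGrading_iff.1 hx b
  have h2 := mem_shiftedGrading_iff.1 (hg b) a
  rw [mem_polyGrading_iff] at h1 h2 ⊢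
  intro m hm
  classical
  rw [Pi.smul_apply, smul_eq_mul, coeff_mul] at hm
  obtain ⟨q, hq, hne⟩ := Finset.exists_ne_zero_of_sum_ne_zero hm
  have h3 := h1 _ (left_ne_zero_of_mul hne)
  have h4 := h2 _ (right_ne_zero_of_mul hne)
  rw [← Finset.HasAntidiagonal.mem_antidiagonal.1 hq, map_add]
  push_cast
  omega

/-- A minimal graded free cover of a homogeneous submodule of a graded free module. -/
theorem IsHomogeneousSubmodule.exists_cover [Finite V] {n : ℕ} {δ : Fin n → ℤ}
    {N : Submodule (MvPolynomial V K) (Fin n → MvPolynomial V K)}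
    (hN : IsHomogeneousSubmodule δ N) :
    ∃ (n' : ℕ) (δ' : Fin n' → ℤ)
      (φ : (Fin n' → MvPolynomial V K) →ₗ[MvPolynomial V K] (Fin n → MvPolynomial V K)),
      (∀ j, ∀ x ∈ shiftedGrading V K δ' j, φ x ∈ shiftedGrading V K δ j) ∧
        LinearMap.range φ = N ∧ ∀ x, φ x = 0 → ∀ b, x b ∈ idealOfVars V K := by
  classical
  let P : ℕ → Prop := fun k => ∃ S : Finset (Fin n → MvPolynomial V K), S.card = k ∧
    (∀ x ∈ S, ∃ j, x ∈ shiftedGrading V K δ j) ∧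
      Submodule.span (MvPolynomial V K) (S : Set (Fin n → MvPolynomial V K)) = N
  have hP : ∃ k, P k := by
    obtain ⟨S, hS⟩ := hN.exists_generators
    exact ⟨_, S, rfl, hS⟩
  obtain ⟨S, hcard, hhom, hspan⟩ := Nat.find_spec hP
  let g : Fin S.card → Fin n → MvPolynomial V K := fun b => S.equivFin.symm b
  have hgS : ∀ b, g b ∈ S := fun b => (S.equivFin.symm b).2
  have hginj : Function.Injective g := fun a b h => S.equivFin.symm.injective (Subtype.ext h)
  have hrange : Set.range g = S := by
    ext x
    constructor
    · rintro ⟨b, rfl⟩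
      exact hgS b
    · intro hx
      exact ⟨S.equivFin ⟨x, hx⟩, by simp [g]⟩
  choose δ' hδ' using fun b => hhom (g b) (hgS b)
  have hφ := linearCombination_mem_shiftedGrading hδ'
  refine ⟨S.card, δ', Fintype.linearCombination (MvPolynomial V K) g, hφ, ?_, fun x hx b => ?_⟩
  · rw [Fintype.range_linearCombination, hrange, hspan]
  · by_contra hb
    have hc : constantCoeff (x b) ≠ 0 := by
      intro h
      refine hb ?_
      rw [← pow_one (idealOfVars V K), mem_pow_idealOfVars_iff']
      intro m hm
      have : m = 0 := by
        rw [← Finsupp.degree_eq_zero_iff]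
        omega
      rw [this]
      exact h
    -- In the component of degree `δ' b` the entry at `b` is a nonzero scalar, so the relation
    -- expresses `g b` by the other generators, contradicting minimality.
    set y := shiftedComp δ' (δ' b) x with hy
    have hy0 : Fintype.linearCombination (MvPolynomial V K) g y = 0 := by
      rw [hy, shiftedComp_comm _ hφ, hx, map_zero]
    have hyb : y b = C (constantCoeff (x b)) := by
      rw [hy, shiftedComp_apply, sub_self]
      ext m
      rw [coeff_polyComp, coeff_C]
      by_cases hm : m = 0
      · subst hm
        simp [constantCoeff_eq]
      · rw [if_neg (Ne.symm hm), if_neg]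
        rwa [Nat.cast_eq_zero, Finsupp.degree_eq_zero_iff]
    rw [Fintype.linearCombination_apply, ← Finset.add_sum_erase _ _ (Finset.mem_univ b), hyb]
      at hy0
    have hgb : g b ∈ Submodule.span (MvPolynomial V K)
        ((S.erase (g b) : Finset _) : Set (Fin n → MvPolynomial V K)) := by
      have h1 : g b = -(C (constantCoeff (x b))⁻¹ : MvPolynomial V K) •
          ∑ a ∈ Finset.univ.erase b, y a • g a := by
        rw [← neg_eq_iff_add_eq_zero.2 hy0, neg_smul_neg, smul_smul, ← C_mul,
          inv_mul_cancel₀ hc, C_1, one_smul]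
      refine (congrArg (· ∈ Submodule.span (MvPolynomial V K)
        ((S.erase (g b) : Finset _) : Set (Fin n → MvPolynomial V K))) h1).mpr ?_
      refine Submodule.smul_mem _ _ (Submodule.sum_mem _ fun a ha => Submodule.smul_mem _ _
        (Submodule.subset_span ?_))
      exact Finset.mem_erase.2 ⟨fun h => Finset.ne_of_mem_erase ha (hginj h), hgS a⟩
    refine Nat.find_min hP (m := (S.erase (g b)).card) ?_ ⟨_, rfl, fun x hx =>
      hhom x (Finset.mem_of_mem_erase hx), ?_⟩
    · rw [← hcard]
      exact Finset.card_erase_lt_of_mem (hgS b)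
    · rw [← hspan]
      conv_rhs => rw [← Finset.insert_erase (hgS b), Finset.coe_insert]
      exact (Submodule.span_insert_eq_span hgb).symm

variable (V K) in
/-- A homogeneous submodule of a graded free module of finite rank. -/
structure HomogeneousSyzygy where
  rank : ℕ
  deg : Fin rank → ℤ
  module : Submodule (MvPolynomial V K) (Fin rank → MvPolynomial V K)
  homogeneous : IsHomogeneousSubmodule deg module

namespace HomogeneousSyzygy

variable [Finite V] (Z : HomogeneousSyzygy V K)

/-- The size of a minimal homogeneous generating set. -/
noncomputable def coverRank : ℕ := Z.homogeneous.exists_cover.choose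

/-- The degrees of a minimal homogeneous generating set. -/
noncomputable def coverDeg : Fin Z.coverRank → ℤ :=
  Z.homogeneous.exists_cover.choose_spec.choose

/-- The map onto a homogeneous submodule from its minimal graded free cover. -/
noncomputable def coverMap :
    (Fin Z.coverRank → MvPolynomial V K) →ₗ[MvPolynomial V K] (Fin Z.rank → MvPolynomial V K) :=
  Z.homogeneous.exists_cover.choose_spec.choose_spec.choose

theorem coverMap_mem : ∀ j, ∀ x ∈ shiftedGrading V K Z.coverDeg j,
    Z.coverMap x ∈ shiftedGrading V K Z.deg j :=
  Z.homogeneous.exists_cover.choose_spec.choose_spec.choose_spec.1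

theorem range_coverMap : LinearMap.range Z.coverMap = Z.module :=
  Z.homogeneous.exists_cover.choose_spec.choose_spec.choose_spec.2.1

theorem mem_idealOfVars_of_coverMap_eq_zero :
    ∀ x, Z.coverMap x = 0 → ∀ b, x b ∈ idealOfVars V K :=
  Z.homogeneous.exists_cover.choose_spec.choose_spec.choose_spec.2.2

/-- The kernel of the minimal graded free cover. -/
noncomputable def next : HomogeneousSyzygy V K where
  rank := Z.coverRank
  deg := Z.coverDeg
  module := LinearMap.ker Z.coverMap
  homogeneous := IsHomogeneousSubmodule.ker _ Z.coverMap_mem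

/-- The iterated syzygies. -/
noncomputable def iter : ℕ → HomogeneousSyzygy V K
  | 0 => Z
  | i + 1 => (iter i).next

end HomogeneousSyzygy

/-- The ideal `I` as a submodule of the graded free module of rank one, if `I` is homogeneous. -/
noncomputable def idealSyzygy (I : Ideal (MvPolynomial V K))
    (hI : ∀ f ∈ I, ∀ j, polyComp j f ∈ I) : HomogeneousSyzygy V K where
  rank := 1
  deg := fun _ => 0
  module := Submodule.comap (LinearMap.proj (R := MvPolynomial V K)
    (φ := fun _ : Fin 1 => MvPolynomial V K) 0) I
  homogeneous _ hx _ := hI _ hx _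

theorem nonempty_minimalGradedFreeResolution_ideal [Finite V] (I : Ideal (MvPolynomial V K))
    (hI : ∀ f ∈ I, ∀ j, polyComp j f ∈ I) :
    Nonempty (MinimalGradedFreeResolution (V := V) (idealGrading I)) := by
  let Z := idealSyzygy I hI
  have hmem : ∀ x, Z.coverMap x (0 : Fin 1) ∈ I := fun x => by
    have : Z.coverMap x ∈ LinearMap.range Z.coverMap := ⟨x, rfl⟩
    rw [Z.range_coverMap] at this
    exact this
  let ε : (Fin Z.next.rank → MvPolynomial V K) →ₗ[MvPolynomial V K] I :=
    LinearMap.codRestrict I ((LinearMap.proj (R := MvPolynomial V K)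
      (φ := fun _ : Fin Z.rank => MvPolynomial V K) (0 : Fin 1)).comp Z.coverMap) hmem
  have hε : ∀ x, ε x = 0 ↔ Z.coverMap x = 0 := by
    intro x
    rw [← Subtype.coe_inj]
    constructor
    · intro h
      funext i
      obtain rfl : i = (0 : Fin 1) := Subsingleton.elim (α := Fin 1) _ _
      exact h
    · intro h
      change Z.coverMap x (0 : Fin 1) = 0
      rw [h]
      rfl
  have hexact : ∀ i, Function.Exact (Z.iter (i + 1)).coverMap (Z.iter i).coverMap := by
    intro i x
    have := (Z.iter (i + 1)).range_coverMap
    change _ ↔ x ∈ LinearMap.range (Z.iter (i + 1)).coverMap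
    rw [this]
    exact Iff.rfl
  exact ⟨{
    -- `Z.iter 0` is the ideal inside `R`, so the covering free modules start at index `1`.
    rank := fun i => (Z.iter (i + 1)).rank
    deg := fun i => (Z.iter (i + 1)).deg
    d := fun i => (Z.iter (i + 1)).coverMap
    ε := ε
    d_homogeneous := fun i => (Z.iter (i + 1)).coverMap_mem
    ε_homogeneous := fun j x hx => by
      have := mem_shiftedGrading_iff.1 (Z.coverMap_mem j x hx) (0 : Fin 1)
      rwa [show j - Z.deg (0 : Fin 1) = j from sub_zero j] at this
    ε_surjective := fun f => by
      have : (fun _ => (f : MvPolynomial V K)) ∈ Z.module := f.2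
      rw [← Z.range_coverMap] at this
      obtain ⟨x, hx⟩ := this
      exact ⟨x, Subtype.ext (congrFun hx (0 : Fin 1))⟩
    exact_zero := fun x => (hε x).trans (hexact 0 x)
    exact_succ := fun i => hexact (i + 1)
    minimal := fun i x b => (Z.iter i).mem_idealOfVars_of_coverMap_eq_zero _
      ((hexact i _).2 ⟨x, rfl⟩) b }⟩

/-- A minimal graded free resolution of `R ⧸ I` from one of `I`. -/
noncomputable def MinimalGradedFreeResolution.ofIdeal {I : Ideal (MvPolynomial V K)}
    (hI : I ≤ idealOfVars V K)
    (F : MinimalGradedFreeResolution (V := V) (idealGrading I)) :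
    MinimalGradedFreeResolution (V := V) (quotientGrading I) where
  rank := fun i => Nat.casesOn i 1 F.rank
  deg := fun i => Nat.casesOn i (fun _ => 0) F.deg
  d := fun i => Nat.casesOn i
    (LinearMap.pi fun _ : Fin 1 => I.subtype ∘ₗ F.ε) F.d
  ε := I.mkQ ∘ₗ LinearMap.proj (0 : Fin 1)
  d_homogeneous := fun i => by
    cases i with
    | zero =>
      intro j x hx
      refine mem_shiftedGrading_iff.2 fun b => ?_
      have := F.ε_homogeneous j x hx
      change _ ∈ polyGrading V K (j - 0)
      rw [sub_zero]
      exact this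
    | succ i => exact F.d_homogeneous i
  ε_homogeneous := fun j x hx => by
    have := mem_shiftedGrading_iff.1 hx (0 : Fin 1)
    refine ⟨x (0 : Fin 1), ?_, rfl⟩
    change _ ∈ polyGrading V K (j - 0) at this
    rwa [sub_zero] at this
  ε_surjective := fun y => by
    obtain ⟨f, rfl⟩ := I.mkQ_surjective y
    exact ⟨fun _ => f, rfl⟩
  exact_zero := fun x => by
    change I.mkQ (x (0 : Fin 1)) = 0 ↔ _
    rw [Submodule.mkQ_apply, Submodule.Quotient.mk_eq_zero]
    constructor
    · intro h
      obtain ⟨y, hy⟩ := F.ε_surjective ⟨_, h⟩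
      refine ⟨y, ?_⟩
      funext i
      obtain rfl : i = (0 : Fin 1) := Subsingleton.elim (α := Fin 1) _ _
      exact congrArg Subtype.val hy
    · rintro ⟨y, rfl⟩
      exact (F.ε y).2
  exact_succ := fun i => by
    cases i with
    | zero =>
      intro x
      refine Iff.trans ?_ (F.exact_zero x)
      constructor
      · intro h
        exact Subtype.ext (congrFun h (0 : Fin 1))
      · intro h
        funext i
        change ((F.ε x : I) : MvPolynomial V K) = 0
        rw [h]
        rfl
    | succ i => exact F.exact_succ i
  minimal := fun i => by
    cases i with
    | zero => exact fun x b => hI (F.ε x).2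
    | succ i => exact F.minimal i

end Existence

/-! ### The main theorem -/

section Main

variable {V K : Type*} [Field K]

theorem MinimalGradedFreeResolution.betti_ne_zero_iff {M : Type*} [AddCommGroup M] [Module K M]
    [Module (MvPolynomial V K) M] {ℳ : ℤ → Submodule K M}
    (F : MinimalGradedFreeResolution (V := V) ℳ) (i : ℕ) (j : ℤ) :
    F.betti i j ≠ 0 ↔ ∃ b, F.deg i b = j := by
  rw [betti, ← Nat.pos_iff_ne_zero, Nat.card_pos_iff]
  constructor
  · rintro ⟨⟨b, hb⟩, -⟩
    exact ⟨b, hb⟩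
  · rintro ⟨b, hb⟩
    exact ⟨⟨b, hb⟩, inferInstance⟩

/-- In degree `j`, the augmentation of a graded free resolution of `R ⧸ I` is surjective. -/
theorem MinimalGradedFreeResolution.image_ε {I : Ideal (MvPolynomial V K)}
    (hI : ∀ f ∈ I, ∀ j, polyComp j f ∈ I)
    (F : MinimalGradedFreeResolution (V := V) (quotientGrading I)) (j : ℤ) :
    F.ε '' (shiftedGrading V K (F.deg 0) j : Set _) = (quotientGrading I j : Set _) := by
  -- Homogeneity of `I` lets the degree `j` component descend to the quotient, which makes the
  -- surjection `ε` surjective degree by degree.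
  let π : MvPolynomial V K ⧸ I →+ MvPolynomial V K ⧸ I :=
    QuotientAddGroup.map I.toAddSubgroup I.toAddSubgroup (polyComp j).toAddMonoidHom
      fun f hf => hI f hf j
  have hπ : ∀ f, π (Ideal.Quotient.mk I f) = Ideal.Quotient.mk I (polyComp j f) := fun _ => rfl
  have hcomm := eq_of_eq_on_shiftedGrading (δ := F.deg 0) (α := π.comp F.ε.toAddMonoidHom)
    (β := F.ε.toAddMonoidHom.comp (shiftedComp (F.deg 0) j).toAddMonoidHom) (by
      intro i x hx
      obtain ⟨f, hf, hfx⟩ := F.ε_homogeneous i x hx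
      simp only [AddMonoidHom.comp_apply, LinearMap.toAddMonoidHom_coe]
      rw [shiftedComp_of_mem hx, ← hfx]
      refine (hπ f).trans ?_
      rw [polyComp_of_mem hf]
      split_ifs
      · exact hfx
      · simp)
  apply Set.Subset.antisymm
  · rintro _ ⟨x, hx, rfl⟩
    exact F.ε_homogeneous j x hx
  · rintro _ ⟨f, hf, rfl⟩
    obtain ⟨x, hx⟩ := F.ε_surjective (Ideal.Quotient.mk I f)
    refine ⟨shiftedComp (F.deg 0) j x, shiftedComp_mem _ _, ?_⟩
    have := DFunLike.congr_fun hcomm x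
    simp only [AddMonoidHom.comp_apply, LinearMap.toAddMonoidHom_coe] at this
    rw [← this, hx, hπ, polyComp_of_mem hf, if_pos rfl]
    rfl

theorem koszulExact_quotientGrading_iff [Fintype V] [LinearOrder V] {I : Ideal (MvPolynomial V K)}
    {s : ℤ} :
    KoszulExact V K (fun j => (quotientGrading I j : Set (MvPolynomial V K ⧸ I))) s ↔
      QuotientKoszulExact I s := by
  constructor
  · intro h c hc hd
    obtain ⟨b, hb, hbd⟩ := h (fun T => I.mkQ (c T)) (fun T => ⟨c T, hc T, rfl⟩) (by
      rw [koszulD_map]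
      funext T
      exact (Submodule.Quotient.mk_eq_zero I).2 (hd T))
    choose g hg hgb using hb
    obtain rfl : (fun T => I.mkQ (g T)) = b := funext hgb
    refine ⟨g, hg, fun T => ?_⟩
    rw [koszulD_map] at hbd
    rw [← neg_mem_iff, Pi.sub_apply, neg_sub]
    exact (Submodule.Quotient.eq I).1 (congrFun hbd T)
  · intro h c hc hd
    choose g hg hgc using hc
    obtain rfl : (fun T => I.mkQ (g T)) = c := funext hgc
    rw [koszulD_map] at hd
    obtain ⟨b, hb, hbd⟩ := h g hg fun T => (Submodule.Quotient.mk_eq_zero I).1 (congrFun hd T)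
    refine ⟨fun T => I.mkQ (b T), fun T => ⟨b T, hb T, rfl⟩, ?_⟩
    rw [koszulD_map]
    funext T
    exact ((Submodule.Quotient.eq I).2 (hbd T)).symm

theorem polyComp_mem_edgeIdeal [Finite V] {G : SimpleGraph V} {f : MvPolynomial V K}
    (hf : f ∈ edgeIdeal K G) (j : ℤ) : polyComp j f ∈ edgeIdeal K G := by
  have := Fintype.ofFinite V
  rw [edgeIdeal_eq_restrictedIdeal] at hf ⊢
  intro m hm
  rw [coeff_polyComp] at hm
  split_ifs at hm
  · exact hf m hm
  · exact absurd rfl hm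

theorem edgeIdeal_le_idealOfVars (G : SimpleGraph V) : edgeIdeal K G ≤ idealOfVars V K := by
  rw [edgeIdeal, Ideal.span_le]
  rintro _ ⟨u, v, -, rfl⟩
  exact Ideal.mul_mem_right _ _ (Ideal.subset_span ⟨u, rfl⟩)

/-- The order adapted to a maximum induced matching serves both bounds: the strand of its size is
not exact, and all higher strands are. -/
theorem IsChordal.isGreatest_quotient [Finite V] {G : SimpleGraph V} (hG : IsChordal G)
    (F : MinimalGradedFreeResolution (V := V) (quotientGrading (edgeIdeal K G))) :
    IsGreatest {s : ℤ | ∃ (i : ℕ) (j : ℤ), F.betti i j ≠ 0 ∧ s = j - i}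
      (inducedMatchingNumber G) := by
  have := Fintype.ofFinite V
  obtain ⟨⟨C, hC, hcard⟩, hmax⟩ := isGreatest_inducedMatchingNumber G
  obtain ⟨o, hlow⟩ := hC.exists_not_quotientKoszulExact K
  have hF := F.image_ε fun f hf j => polyComp_mem_edgeIdeal hf j
  constructor
  · by_contra hcon
    refine hlow ?_
    rw [← edgeIdeal_eq_restrictedIdeal, ← koszulExact_quotientGrading_iff, hcard]
    refine F.koszulExact_of_deg_ne hF fun i b hb => hcon ⟨i, _, (F.betti_ne_zero_iff i _).2
      ⟨b, rfl⟩, ?_⟩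
    omega
  · rintro s ⟨i, j, hij, rfl⟩
    obtain ⟨b, rfl⟩ := (F.betti_ne_zero_iff i j).1 hij
    by_contra hcon
    have hex : QuotientKoszulExact (edgeIdeal K G) (F.deg i b - i) := by
      generalize F.deg i b - (i : ℤ) = s at hcon
      rw [edgeIdeal_eq_restrictedIdeal]
      refine hG.quotientKoszulExact _ _ fun C hC _ => ?_
      have : C.card ≤ inducedMatchingNumber G := hmax ⟨C, hC, rfl⟩
      omega
    refine F.deg_ne_of_koszulExact hF (koszulExact_quotientGrading_iff.2 hex) i b ?_
    omega

theorem inducedMatchingNumber_pos [Finite V] {G : SimpleGraph V} (h : G.edgeSet.Nonempty) :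
    0 < inducedMatchingNumber G := by
  obtain ⟨e, he⟩ := h
  refine (isGreatest_inducedMatchingNumber G).2 ⟨{e}, ⟨by simpa using he, ?_, ?_⟩, by simp⟩
  · intro a ha b hb hab
    rw [Finset.mem_singleton] at ha hb
    exact absurd (ha.trans hb.symm) hab
  · intro f hf hcov
    induction f with
    | _ a b =>
      have hab : G.Adj a b := hf
      have h1 : a ∈ e := by simpa using hcov a (Sym2.mem_mk_left a b)
      have h2 : b ∈ e := by simpa using hcov b (Sym2.mem_mk_right a b)
      rw [Finset.mem_singleton]
      exact ((Sym2.mem_and_mem_iff hab.ne).1 ⟨h1, h2⟩).symm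

end Main

end EdgeIdealRegularity

theorem mainTheorem1 {V K : Type*} [Finite V] [Field K] (G : SimpleGraph V)
    (hG : EdgeIdealRegularity.IsChordal G) :
    (G.edgeSet.Nonempty →
      EdgeIdealRegularity.HasRegularity V
        (EdgeIdealRegularity.idealGrading (EdgeIdealRegularity.edgeIdeal K G))
        (EdgeIdealRegularity.inducedMatchingNumber G + 1)) ∧
    EdgeIdealRegularity.HasRegularity V
      (EdgeIdealRegularity.quotientGrading (EdgeIdealRegularity.edgeIdeal K G))
      (EdgeIdealRegularity.inducedMatchingNumber G) := by
  have hres := EdgeIdealRegularity.nonempty_minimalGradedFreeResolution_ideal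
    (EdgeIdealRegularity.edgeIdeal K G)
    fun f hf j => EdgeIdealRegularity.polyComp_mem_edgeIdeal hf j
  have hle := EdgeIdealRegularity.edgeIdeal_le_idealOfVars (K := K) G
  refine ⟨fun hne => ⟨hres, fun F => ?_⟩, ⟨hres.some.ofIdeal hle⟩, hG.isGreatest_quotient⟩
  have hpos := EdgeIdealRegularity.inducedMatchingNumber_pos hne
  -- Prepending `R` raises homological degrees by one, so `j - i` for the ideal exceeds that for the
  -- quotient by one.
  obtain ⟨⟨i, j, hij, hs⟩, hmax⟩ := hG.isGreatest_quotient (F.ofIdeal hle)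
  constructor
  · obtain ⟨b, hb⟩ := ((F.ofIdeal hle).betti_ne_zero_iff i j).1 hij
    cases i with
    | zero =>
      -- The prepended `R` contributes only the value `0`, which is not the maximum because an edge
      -- makes `ν(G)` positive.
      have : (0 : ℤ) = j := hb
      omega
    | succ i =>
      refine ⟨i, j, (F.betti_ne_zero_iff i j).2 ⟨b, hb⟩, ?_⟩
      push_cast at hs
      omega
  · rintro s ⟨i, j, hij, rfl⟩
    obtain ⟨b, hb⟩ := (F.betti_ne_zero_iff i j).1 hij
    have := hmax ⟨i + 1, j, ((F.ofIdeal hle).betti_ne_zero_iff (i + 1) j).2 ⟨b, hb⟩, rfl⟩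
    push_cast at this
    omega
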